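/- Let $n\ge 0$ be an integer. **Ensembles.** For $A<1$ let the superimposed Laguerre ensemble be the probability density on $x_1>x_2>\cdots>x_{2n}\ge 0$ $$\frac1C\prod_{j=1}^{2n}e^{-x_j/2}\prod_{j=1}^{n}e^{A(x_{2j-1}-x_{2j})/2}\prod_{1\le j<k\le n}(x_{2j-1}-x_{2k-1})(x_{2j}-x_{2k}).$$ For $a>-1$ and $A<a+1$ let the superimposed Jacobi ensemble be the probability density on $1>x_1>x_2>\cdots>x_{2n}>-1$ $$\frac1C\prod_{j=1}^{2n}(1-x_j)^{(a-1)/2}\prod_{l=1}^{n}\Big(\frac{1-x_{2l-1}}{1-x_{2l}}\Big)^{-A/2}\prod_{1\le j<k\le n}(x_{2j-1}-x_{2k-1})(x_{2j}-x_{2k}).$$ In both cases $C$ is the normalization. Put $I=[0,\infty)$, resp. $I=(-1,1)$. Let $p(x_1,\dots,x_n;y_1,\dots,y_n)$ be the probability density on $I^n\times I^n$, symmetric in the $x$'s and in the $y$'s, in which the $x$'s are the odd labelled and the $y$'s the even labelled coordinates. For $0\le k_1,k_2\le n$ the $(k_1,k_2)$-point parity respecting correlation is $$\rho_{(k_1,k_2)}(x_1,\dots,x_{k_1};y_1,\dots,y_{k_2})=\frac{n!}{(n-k_1)!}\,\frac{n!}{(n-k_2)!}\int_{I^{n-k_1}}dx_{k_1+1}\cdots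 dx_n\int_{I^{n-k_2}}dy_{k_2+1}\cdots dy_n\; p(x_1,\dots,x_n;y_1,\dots,y_n).$$ **Kernels.** With $L_l$ the Laguerre polynomials (parameter $0$), $P_l^{(a,0)}$ the Jacobi polynomials and $h_l^J=2^{a+1}/(2l+a+1)$, put $$K_n^L(x,y)=e^{-(x+y)/2}\sum_{l=0}^{n-1}L_l(x)L_l(y),\qquad K_n^J(x,y)=(1-x)^{(a-1)/2}(1-y)^{(a-1)/2}\sum_{l=0}^{n-1}\frac{1}{h_l^J}P_l^{(a,0)}(x)P_l^{(a,0)}(y),$$ and let $\chi_{x>y}$ be $1$ if $x>y$ and $0$ otherwise. **Claim.** In both cases the unnormalized density is integrable with positive integral, and for all $k_1,k_2\le n$ and all $x_1,\dots,x_{k_1},y_1,\dots,y_{k_2}\in I$ with $x_i\ne y_j$ for all $i,j$ the integral defining $\rho_{(k_1,k_2)}$ converges absolutely and $$\rho_{(k_1,k_2)}(x_1,\dots,x_{k_1};y_1,\dots,y_{k_2})=\det\begin{bmatrix}[K_{\rm oo}(x_j,x_l)]_{j,l\le k_1}&[K_{\rm oe}(x_j,y_l)]_{j\le k_1,\,l\le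 k_2}\\ [K_{\rm eo}(y_j,x_l)]_{j\le k_2,\,l\le k_1}&[K_{\rm ee}(y_j,y_l)]_{j,l\le k_2}\end{bmatrix},$$ where in the Laguerre case $$K_{\rm oo}(x,x')=-e^{-A(x-x')/2}\frac{\partial}{\partial x}\Big\{e^{Ax/2}\int_0^{x'}e^{-Au/2}K_n^L(x,u)\,du\Big\},\qquad K_{\rm oe}(x,y)=-e^{-Ax/2}\frac{\partial}{\partial x}\Big\{e^{Ax/2}K_n^L(x,y)\Big\},$$ $$K_{\rm eo}(y,x)=-e^{A(x-y)/2}\chi_{x>y}+e^{Ax/2}\int_0^x e^{-Av/2}K_n^L(v,y)\,dv,\qquad K_{\rm ee}(y,y')=K_n^L(y,y'),$$ and in the Jacobi case $$K_{\rm oo}(x,x')=-\Big(\frac{1-x}{1-x'}\Big)^{A/2}\frac{\partial}{\partial x}\Big\{(1-x)^{1-A/2}\int_{-1}^{x'}(1-u)^{A/2}K_n^J(x,u)\,du\Big\},$$ $$K_{\rm oe}(x,y)=-(1-x)^{A/2}\frac{\partial}{\partial x}\Big\{(1-x)^{1-A/2}K_n^J(x,y)\Big\},$$ $$K_{\rm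 eo}(y,x)=-\Big(\frac{1-x}{1-y}\Big)^{-A/2}\chi_{x>y}+(1-y)(1-x)^{-A/2}\int_{-1}^x(1-v)^{A/2}K_n^J(v,y)\,dv,\qquad K_{\rm ee}(y,y')=(1-y)K_n^J(y,y').$$ In particular, for $k\le n$ and $y_1,\dots,y_k\in I$, the even-even correlations are $$\rho_{(0,k)}(y_1,\dots,y_k)=\det[K_n^L(y_j,y_l)]_{j,l\le k}\quad\text{resp.}\quad \rho_{(0,k)}(y_1,\dots,y_k)=\det[(1-y_j)K_n^J(y_j,y_l)]_{j,l\le k},$$ which do not depend on $A$. -/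

import Mathlib

open MeasureTheory

namespace SuperimposedEnsemble

noncomputable section

/-! ### Classical orthogonal polynomials and the unitary kernels -/

/-- The Laguerre polynomial `L_l` (parameter `0`):
`L_l(x) = ∑_{k ≤ l} (l choose k) (-x)^k / k!`. -/
def laguerreL (l : ℕ) (x : ℝ) : ℝ :=
  ∑ k ∈ Finset.range (l + 1), (l.choose k : ℝ) * (-x) ^ k / (k.factorial : ℝ)

/-- The Jacobi polynomial `P_l^{(a,b)}`:
`P_l^{(a,b)}(x) = ∑_{k ≤ l} (a+k+1)_{l-k} / (l-k)! * (l+a+b+1)_k / k! * ((x-1)/2)^k`,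
with `(c)_m` the rising factorial; for `a > -1` this is
`(a+1)_l / l! * ₂F₁(-l, l+a+b+1; a+1; (1-x)/2)`. -/
def jacobiP (a b : ℝ) (l : ℕ) (x : ℝ) : ℝ :=
  ∑ k ∈ Finset.range (l + 1),
    (ascPochhammer ℝ (l - k)).eval (a + k + 1) / ((l - k).factorial : ℝ) *
      ((ascPochhammer ℝ k).eval (l + a + b + 1) / (k.factorial : ℝ)) * ((x - 1) / 2) ^ k

/-- The norm `h_l = ∫_{-1}^1 (1-t)^a P_l^{(a,0)}(t)^2 dt = 2^{a+1} / (2l+a+1)`. -/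
def jacobiNorm (a : ℝ) (l : ℕ) : ℝ := (2 : ℝ) ^ (a + 1) / (2 * l + a + 1)

/-- The kernel `K_n^L` of the Laguerre unitary ensemble with parameter `0`
(the norms of the Laguerre polynomials are all `1`). -/
def KL (n : ℕ) (x y : ℝ) : ℝ :=
  Real.exp (-(x + y) / 2) * ∑ l ∈ Finset.range n, laguerreL l x * laguerreL l y

/-- The kernel `K_n^J`; `(1 - y) K_n^J(x, y)` is a correlation kernel of the Jacobi unitary
ensemble with weight `(1-x)^a` on `(-1,1)`. -/
def KJ (a : ℝ) (n : ℕ) (x y : ℝ) : ℝ :=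
  (1 - x) ^ ((a - 1) / 2) * (1 - y) ^ ((a - 1) / 2) *
    ∑ l ∈ Finset.range n, 1 / jacobiNorm a l * jacobiP a 0 l x * jacobiP a 0 l y

/-! ### The ensembles

Configurations `z : Fin (2 * n) → ℝ` are listed in decreasing order, `z 0 > z 1 > ⋯`.  Counting
labels from one, the odd labelled coordinates are `z (2j)` and the even labelled ones are
`z (2j+1)`, for `j = 0, …, n-1`. -/

/-- Position of the `j`-th odd labelled coordinate. -/
def oddPos {n : ℕ} (j : Fin n) : Fin (2 * n) := ⟨2 * j, by omega⟩

/-- Position of the `j`-th even labelled coordinate. -/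
def evenPos {n : ℕ} (j : Fin n) : Fin (2 * n) := ⟨2 * j + 1, by omega⟩

/-- The product of the differences of the odd labelled coordinates and of the differences of the
even labelled coordinates. -/
def parityVandermonde {n : ℕ} (z : Fin (2 * n) → ℝ) : ℝ :=
  ∏ j : Fin n, ∏ k ∈ Finset.Ioi j,
    (z (oddPos j) - z (oddPos k)) * (z (evenPos j) - z (evenPos k))

open Classical in
/-- The unnormalized density of the superimposed Laguerre ensemble with parameter `A`, on
`z 0 > z 1 > ⋯ > z (2n-1) ≥ 0`. -/
def laguerreWeight (A : ℝ) {n : ℕ} (z : Fin (2 * n) → ℝ) : ℝ :=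
  if StrictAnti z ∧ ∀ i, 0 ≤ z i then
    (∏ i, Real.exp (-z i / 2)) *
      (∏ j : Fin n, Real.exp (A * (z (oddPos j) - z (evenPos j)) / 2)) * parityVandermonde z
  else 0

open Classical in
/-- The unnormalized density of the superimposed Jacobi ensemble with parameters `a`, `A`, on
`1 > z 0 > z 1 > ⋯ > z (2n-1) > -1`. -/
def jacobiWeight (a A : ℝ) {n : ℕ} (z : Fin (2 * n) → ℝ) : ℝ :=
  if StrictAnti z ∧ ∀ i, z i ∈ Set.Ioo (-1 : ℝ) 1 then
    (∏ i, (1 - z i) ^ ((a - 1) / 2)) *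
      (∏ j : Fin n, ((1 - z (oddPos j)) / (1 - z (evenPos j))) ^ (-A / 2)) * parityVandermonde z
  else 0

/-- The weight `W` can be normalized to a probability density. -/
def Normalizable {n : ℕ} (W : (Fin (2 * n) → ℝ) → ℝ) : Prop :=
  (∀ z, 0 ≤ W z) ∧ Integrable W ∧ 0 < ∫ z, W z

/-- The normalized density `W / C`, where `C = ∫ W`. -/
def normalize {n : ℕ} (W : (Fin (2 * n) → ℝ) → ℝ) (z : Fin (2 * n) → ℝ) : ℝ :=
  W z / ∫ z', W z'

/-- The configuration `x 0, y 0, x 1, y 1, …`. -/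
def interleave {n : ℕ} (x y : Fin n → ℝ) (i : Fin (2 * n)) : ℝ :=
  if (i : ℕ) % 2 = 0 then x ⟨i / 2, by omega⟩ else y ⟨i / 2, by omega⟩

/-- The two species density `p(x_1,…,x_n; y_1,…,y_n)` of a density `P` on ordered
configurations: it is symmetric in the odd labelled coordinates `x` and in the even labelled
coordinates `y`.  As `P` vanishes off decreasing configurations, at most one term of the sum is
nonzero. -/
def twoSpecies {n : ℕ} (P : (Fin (2 * n) → ℝ) → ℝ) (x y : Fin n → ℝ) : ℝ :=
  1 / (n.factorial : ℝ) ^ 2 *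
    ∑ σ : Equiv.Perm (Fin n), ∑ τ : Equiv.Perm (Fin n), P (interleave (x ∘ σ) (y ∘ τ))

/-! ### Correlation functions -/

/-- For `k ≤ n`, the point of `ℝⁿ` with first `k` coordinates `x` and last `n - k` ones `s`. -/
def extend {n k : ℕ} (x : Fin k → ℝ) (s : Fin (n - k) → ℝ) (i : Fin n) : ℝ :=
  if h : (i : ℕ) < k then x ⟨i, h⟩ else s ⟨i - k, by omega⟩

/-- The integrand in the definition of the `(k₁,k₂)`-point correlation is integrable in the
remaining variables. -/
def SliceIntegrable {n : ℕ} (p : (Fin n → ℝ) → (Fin n → ℝ) → ℝ) {k₁ k₂ : ℕ}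
    (x : Fin k₁ → ℝ) (y : Fin k₂ → ℝ) : Prop :=
  Integrable fun st : (Fin (n - k₁) → ℝ) × (Fin (n - k₂) → ℝ) => p (extend x st.1) (extend y st.2)

/-- The `(k₁,k₂)`-point correlation function of the two species density `p`, for `k₁, k₂ ≤ n`.
The prefactor is `n(n-1)⋯(n-k₁+1) n(n-1)⋯(n-k₂+1)`. -/
def correlation {n : ℕ} (p : (Fin n → ℝ) → (Fin n → ℝ) → ℝ) {k₁ k₂ : ℕ}
    (x : Fin k₁ → ℝ) (y : Fin k₂ → ℝ) : ℝ :=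
  (n.descFactorial k₁ : ℝ) * (n.descFactorial k₂ : ℝ) *
    ∫ st : (Fin (n - k₁) → ℝ) × (Fin (n - k₂) → ℝ), p (extend x st.1) (extend y st.2)

/-- The two species density of the superimposed Laguerre ensemble. -/
def laguerreDensity (n : ℕ) (A : ℝ) : (Fin n → ℝ) → (Fin n → ℝ) → ℝ :=
  twoSpecies (normalize (laguerreWeight A (n := n)))

/-- The two species density of the superimposed Jacobi ensemble. -/
def jacobiDensity (n : ℕ) (a A : ℝ) : (Fin n → ℝ) → (Fin n → ℝ) → ℝ :=
  twoSpecies (normalize (jacobiWeight a A (n := n)))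

/-- The block determinant
`det [[K_oo(x_j,x_l)], [K_oe(x_j,y_l)]; [K_eo(y_j,x_l)], [K_ee(y_j,y_l)]]`. -/
def blockDet (Koo Koe Keo Kee : ℝ → ℝ → ℝ) {k₁ k₂ : ℕ} (x : Fin k₁ → ℝ) (y : Fin k₂ → ℝ) : ℝ :=
  (Matrix.fromBlocks
    (Matrix.of fun j l : Fin k₁ => Koo (x j) (x l))
    (Matrix.of fun (j : Fin k₁) (l : Fin k₂) => Koe (x j) (y l))
    (Matrix.of fun (j : Fin k₂) (l : Fin k₁) => Keo (y j) (x l))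
    (Matrix.of fun j l : Fin k₂ => Kee (y j) (y l))).det

/-! ### The kernels of the Laguerre case -/

def KLoo (n : ℕ) (A x x' : ℝ) : ℝ :=
  -Real.exp (-A * (x - x') / 2) *
    deriv (fun t => Real.exp (A * t / 2) * ∫ u in (0 : ℝ)..x', Real.exp (-A * u / 2) * KL n t u) x

def KLoe (n : ℕ) (A x y : ℝ) : ℝ :=
  -Real.exp (-A * x / 2) * deriv (fun t => Real.exp (A * t / 2) * KL n t y) x

def KLeo (n : ℕ) (A y x : ℝ) : ℝ :=
  -(if y < x then Real.exp (A * (x - y) / 2) else 0) +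
    Real.exp (A * x / 2) * ∫ v in (0 : ℝ)..x, Real.exp (-A * v / 2) * KL n v y

def KLee (n : ℕ) (y y' : ℝ) : ℝ := KL n y y'

/-! ### The kernels of the Jacobi case -/

def KJoo (n : ℕ) (a A x x' : ℝ) : ℝ :=
  -((1 - x) / (1 - x')) ^ (A / 2) *
    deriv (fun t => (1 - t) ^ (1 - A / 2) *
      ∫ u in (-1 : ℝ)..x', (1 - u) ^ (A / 2) * KJ a n t u) x

def KJoe (n : ℕ) (a A x y : ℝ) : ℝ :=
  -(1 - x) ^ (A / 2) * deriv (fun t => (1 - t) ^ (1 - A / 2) * KJ a n t y) x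

def KJeo (n : ℕ) (a A y x : ℝ) : ℝ :=
  -(if y < x then ((1 - x) / (1 - y)) ^ (-A / 2) else 0) +
    (1 - y) * (1 - x) ^ (-A / 2) * ∫ v in (-1 : ℝ)..x, (1 - v) ^ (A / 2) * KJ a n v y

def KJee (n : ℕ) (a y y' : ℝ) : ℝ := (1 - y) * KJ a n y y'

end

end SuperimposedEnsemble

open SuperimposedEnsemble

namespace SuperimposedEnsemble

/-! ### Determinants -/

section Determinants

open Matrix

variable {κ : Type*} [Fintype κ] [DecidableEq κ]

/-! For decreasing x and y, the determinant of the indicators of y_l < x_j is one if the two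
configurations interlace and zero otherwise (`det_lt_indicator`). Hence, up to a positive constant
and off the coincidences x_i = y_j, the symmetrized density is det[φ_i(x_j)] · det[f(x_j, y_l)] ·
det[ψ_i(y_j)]. Here φ_i and ψ_i are a weight w times polynomials of exact degree i, and f(x, y) is
g(x)/g(y) for y < x and zero otherwise, with g = e^{Ax/2}, resp. (1-x)^{-A/2}.

Suppose ∫∫ φ_i f ψ_j = δ_ij, and put α_i = ∫ f ψ_i, β_i = ∫ φ_i f. On the disjoint union of odd and
even points take K(a, b) = ∑ U_i(a) V_i(b) - N(a, b), where U is φ on odd and β on even points, V is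
α on odd and ψ on even points, and N is f at an (even, odd) pair and zero otherwise. At n odd and n
even points det K is the triple product above (`D_eq_mul`, by the block factorization
`det_fromBlocks_chain`). The integral of K(a, t) K(t, b) over odd t is K(a, b) for odd a and 0 for
even a; over even t it is K(a, b) for even b and 0 for odd b. Together with ∫ K(t, t) dt = n,
expansion of a bordered determinant shows that integrating out a further point of a species that
already has k points multiplies the determinant by n - k (`hasIntegral_corr_inl`,
`hasIntegral_corr_inr`). Iteration gives the normalization and all correlations (`lintegral_D`,
`correlation_eq_D`). The determinants being nonnegative, Tonelli suffices and absolute convergence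
comes with it.

The kernels become explicit for the following choice. Let ψ_i = w q_i with q_i the orthonormal
Laguerre, resp. Jacobi, polynomials, and choose φ_i so that φ_i g is minus the derivative of g w
q_i, resp. of (1-x) g w q_i. The integral defining β_i telescopes to w q_i, resp. (1-y) w q_i; its
boundary term vanishes because A < 1, resp. A < a + 1. Biorthogonality is then classical
orthogonality for e^{-x}, resp. (1-x)^a, and the even-even block does not involve A. Orthogonality
itself follows from moments, as finite differences annihilate polynomials of low degree. -/

lemma det_fromBlocks_border_mul_det {R : Type*} [CommRing R] (A : Matrix κ κ R) (c r : κ → R)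
    (d : R) :
    (fromBlocks A (replicateCol Unit c) (replicateRow Unit r) (of fun _ _ => d)).det * A.det =
      (d * A.det - r ⬝ᵥ (A.adjugate *ᵥ c)) * A.det := by
  -- The second factor clears the upper right block. Using the adjugate in place of an inverse
  -- avoids any regularity assumption, at the price of a factor `A.det` on both sides.
  have h : fromBlocks A (replicateCol Unit c) (replicateRow Unit r) (of fun _ _ => d) *
      fromBlocks 1 (replicateCol Unit (-(A.adjugate *ᵥ c))) 0 (of fun _ _ => A.det) =
      fromBlocks A 0 (replicateRow Unit r)
        (of fun _ _ => d * A.det - r ⬝ᵥ (A.adjugate *ᵥ c)) := by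
    rw [fromBlocks_multiply]
    congr 1
    · simp
    · ext i j
      have := congrFun (congrArg (fun M => M *ᵥ c) (mul_adjugate A)) i
      simp only [← mulVec_mulVec, smul_mulVec, one_mulVec, Pi.smul_apply, smul_eq_mul] at this
      rw [Matrix.add_apply, Matrix.mul_apply, Matrix.mul_apply]
      simp only [replicateCol_apply, Pi.neg_apply, mul_neg, Finset.sum_neg_distrib,
        Finset.univ_unique, of_apply, Finset.sum_singleton, Matrix.zero_apply]
      rw [show ∑ k, A i k * (A.adjugate *ᵥ c) k = A.det * c i from this]
      ring
    · simp
    · ext i j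
      rw [Matrix.add_apply, Matrix.mul_apply, Matrix.mul_apply]
      simp [dotProduct, sub_eq_add_neg, add_comm]
  have h2 := congrArg det h
  rw [det_mul, det_fromBlocks_zero₂₁, det_fromBlocks_zero₁₂] at h2
  simpa [det_unique, mul_comm] using h2

/-- Expansion of a bordered determinant along the border. -/
lemma det_fromBlocks_border (A : Matrix κ κ ℝ) (c r : κ → ℝ) (d : ℝ) :
    (fromBlocks A (replicateCol Unit c) (replicateRow Unit r) (of fun _ _ => d)).det =
      d * A.det - r ⬝ᵥ (A.adjugate *ᵥ c) := by
  -- To cancel the factor `A.det`, replace `A` by `A + X`, the characteristic matrix of `-A`, whose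
  -- determinant is monic and hence nonzero; then set `X = 0`.
  let P : Matrix κ κ (Polynomial ℝ) := A.map Polynomial.C + (Polynomial.X : Polynomial ℝ) • (1 : Matrix κ κ (Polynomial ℝ))
  have hP : P.det ≠ 0 := by
    have : P = charmatrix (-A) := by
      ext i j : 2
      by_cases h : i = j
      · subst h; simp [P, charmatrix, add_comm]
      · simp [P, charmatrix, h]
    rw [this]
    exact (charpoly_monic (-A)).ne_zero
  have key := mul_right_cancel₀ hP (det_fromBlocks_border_mul_det P (fun i => Polynomial.C (c i))
    (fun i => Polynomial.C (r i)) (Polynomial.C d))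
  have hA : (Polynomial.evalRingHom (0 : ℝ)).mapMatrix P = A := by
    ext i j
    simp [P]
  have k2 := congrArg (Polynomial.evalRingHom (0 : ℝ)) key
  rw [RingHom.map_det, map_sub, map_mul, RingHom.map_det, hA] at k2
  have hadj := RingHom.map_adjugate (Polynomial.evalRingHom (0 : ℝ)) P
  rw [hA] at hadj
  rw [← hadj]
  convert k2 using 2
  · ext i j
    rcases i with i | i <;> rcases j with j | j
    · have := congrFun (congrFun hA i) j
      simpa using this.symm
    all_goals simp
  · simp
  · simp [dotProduct, mulVec, Polynomial.eval_finsetSum]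

/-- The matrix is a product of three unipotent block matrices. It serves to exchange the block
columns in `det_fromBlocks_chain` without a sign. -/
lemma det_fromBlocks_one_neg_one {R : Type*} [CommRing R] :
    (fromBlocks (0 : Matrix κ κ R) (1 : Matrix κ κ R) (-1 : Matrix κ κ R) 0).det = 1 := by
  have : fromBlocks (0 : Matrix κ κ R) (1 : Matrix κ κ R) (-1 : Matrix κ κ R) 0 =
      fromBlocks 1 (1 : Matrix κ κ R) 0 1 * fromBlocks 1 0 (-1 : Matrix κ κ R) 1 *
        fromBlocks 1 (1 : Matrix κ κ R) 0 1 := by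
    simp [fromBlocks_multiply]
  rw [this]
  simp [det_mul]

/-- After the block columns are exchanged, the matrix is a product of a lower and an upper block
triangular matrix, and the two signs from `-Ψ` and `-F` cancel. `B` and `C` will be the values of β
and α: they drop out of the determinant when all points of both species are present. -/
lemma det_fromBlocks_chain {R : Type*} [CommRing R] (Φ F Ψ B C : Matrix κ κ R) :
    (fromBlocks (Φ * C) (Φ * Ψ) (B * C - F) (B * Ψ)).det = Φ.det * F.det * Ψ.det := by
  have h : fromBlocks (Φ * C) (Φ * Ψ) (B * C - F) (B * Ψ) * fromBlocks 0 1 (-1) 0 =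
      fromBlocks Φ 0 B 1 * fromBlocks (-Ψ) C 0 (-F) := by
    simp [fromBlocks_multiply, sub_eq_add_neg]
  have h2 := congrArg det h
  rw [det_mul, det_mul, det_fromBlocks_one_neg_one, mul_one, det_fromBlocks_zero₁₂,
    det_fromBlocks_zero₂₁, det_neg, det_neg, det_one] at h2
  rw [h2]
  have : ((-1 : R) ^ Fintype.card κ) * (-1) ^ Fintype.card κ = 1 := by
    rw [← mul_pow]; simp
  linear_combination (Φ.det * F.det * Ψ.det) * this

end Determinants

/-! ### Interlacing of two decreasing configurations as a determinant -/

section Interlacing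

variable {n : ℕ}

lemma eq_of_strictAnti_of_mem {m : Fin n → ℕ} (hm : StrictAnti m) (h1 : ∀ i, 1 ≤ m i)
    (hn : ∀ i, m i ≤ n) (i : Fin n) : m i = n - i := by
  have up : ∀ (k : ℕ) (hk : k < n), m ⟨k, hk⟩ + k ≤ n := by
    intro k
    induction k with
    | zero => intro hk; simpa using hn _
    | succ k ih =>
      intro hk
      have := ih (by omega)
      have h2 : m ⟨k + 1, hk⟩ < m ⟨k, by omega⟩ := hm (by simp)
      omega
  have dn : ∀ (k : ℕ) (hk : k < n), k + 1 ≤ m ⟨n - 1 - k, by omega⟩ := by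
    intro k
    induction k with
    | zero => intro hk; simpa using h1 _
    | succ k ih =>
      intro hk
      have := ih (by omega)
      have h2 : m ⟨n - 1 - k, by omega⟩ < m ⟨n - 1 - (k + 1), by omega⟩ :=
        hm (by simp only [Fin.lt_def]; omega)
      omega
  have a := up i i.2
  have b := dn (n - 1 - i) (by omega)
  have e : (⟨n - 1 - (n - 1 - i), by omega⟩ : Fin n) = i := by ext; simp only; omega
  rw [e] at b
  simp only [Fin.eta] at a
  omega

open Classical in
/-- For decreasing `x` and `y` the matrix of the indicators of `y l < x j` has determinant one if
`x` and `y` interlace, and zero otherwise. -/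
lemma det_lt_indicator {x y : Fin n → ℝ} (hx : StrictAnti x) (hy : StrictAnti y) :
    (Matrix.of fun j l => if y l < x j then (1 : ℝ) else 0).det =
      if ∀ j l, y l < x j ↔ j ≤ l then 1 else 0 := by
  split_ifs with h
  · rw [Matrix.det_of_isUpperTriangular]
    · simp [h]
    · intro i j hij
      simp only [id_eq] at hij
      simp [h, hij]
  · by_contra hdet
    apply h
    -- Count the `y l` below each `x j`. The sets counted are nested, so equal counts give equal
    -- rows and a zero count gives a zero row. A nonzero determinant thus makes `m` strictly
    -- decreasing with values in `1, …, n`, which forces `m j = n - j`; as `y` decreases, the set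
    -- counted is then exactly the `l ≥ j`.
    let m : Fin n → ℕ := fun j => (Finset.univ.filter fun l => y l < x j).card
    have hsub : ∀ {i j : Fin n}, i ≤ j → (Finset.univ.filter fun l => y l < x j) ⊆
        (Finset.univ.filter fun l => y l < x i) := by
      intro i j hij l
      simp only [Finset.mem_filter, Finset.mem_univ, true_and]
      exact fun hl => hl.trans_le (hx.antitone hij)
    have hm : StrictAnti m := by
      intro i j hij
      refine lt_of_le_of_ne (Finset.card_le_card (hsub hij.le)) fun he => hdet ?_
      have hs := Finset.eq_of_subset_of_card_le (hsub hij.le) he.ge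
      refine Matrix.det_zero_of_row_eq hij.ne ?_
      ext l
      have := congrArg (l ∈ ·) hs
      simp only [Finset.mem_filter, Finset.mem_univ, true_and, eq_iff_iff] at this
      simp [this]
    have h1 : ∀ i, 1 ≤ m i := by
      intro i
      by_contra hi
      have h0 : m i = 0 := by omega
      refine hdet (Matrix.det_eq_zero_of_row_eq_zero i fun l => ?_)
      have := Finset.filter_eq_empty_iff.1 (Finset.card_eq_zero.1 h0) (Finset.mem_univ l)
      simp [this]
    have hn : ∀ i, m i ≤ n := fun i => (Finset.card_le_univ _).trans (by simp)
    intro j l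
    have hmj := eq_of_strictAnti_of_mem hm h1 hn j
    constructor
    · intro hl
      by_contra hlt
      push Not at hlt
      have hc : (Finset.Ici l).card ≤ m j := Finset.card_le_card fun k hk => by
        simp only [Finset.mem_filter, Finset.mem_univ, true_and]
        exact (hy.antitone (Finset.mem_Ici.1 hk)).trans_lt hl
      rw [Fin.card_Ici, hmj] at hc
      have := Fin.lt_def.1 hlt
      omega
    · intro hl
      by_contra hlt
      have hc : m j ≤ (Finset.Ioi l).card := Finset.card_le_card fun k hk => by
        simp only [Finset.mem_filter, Finset.mem_univ, true_and] at hk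
        by_contra hkl
        exact hlt ((hy.antitone (by simpa using hkl)).trans_lt hk)
      rw [Fin.card_Ioi, hmj] at hc
      have := Fin.le_def.1 hl
      omega

end Interlacing

/-! ### Biorthogonal two species systems -/

/-- Functions `φ i`, `ψ i` and a transition function `f`, with `∫∫ φ i (x) f(x, y) ψ j (y) = δ i j`
and a product bound on `f` which makes these integrals absolutely convergent. -/
structure BiorthogonalSystem (ι : Type*) [DecidableEq ι] where
  φ : ι → ℝ → ℝ
  ψ : ι → ℝ → ℝ
  f : ℝ → ℝ → ℝ
  u : ℝ → ℝ
  v : ℝ → ℝ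
  measurable_φ : ∀ i, Measurable (φ i)
  measurable_ψ : ∀ i, Measurable (ψ i)
  measurable_f : Measurable (Function.uncurry f)
  abs_f_le : ∀ x y, |f x y| ≤ u x * v y
  integrable_φ : ∀ i, Integrable fun x => φ i x * u x
  integrable_ψ : ∀ i, Integrable fun y => ψ i y * v y
  biorthogonal : ∀ i j, ∫ y, (∫ x, φ i x * f x y) * ψ j y = if i = j then 1 else 0

namespace BiorthogonalSystem

variable {ι : Type*} [DecidableEq ι] (S : BiorthogonalSystem ι)

/-- The function `α i (x) = ∫ f(x, y) ψ i (y) dy`. -/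
noncomputable def α (i : ι) (x : ℝ) : ℝ := ∫ y, S.f x y * S.ψ i y

/-- The function `β i (y) = ∫ φ i (x) f(x, y) dx`. -/
noncomputable def β (i : ι) (y : ℝ) : ℝ := ∫ x, S.φ i x * S.f x y

lemma abs_f_le_abs (x y : ℝ) : |S.f x y| ≤ |S.u x| * |S.v y| :=
  (S.abs_f_le x y).trans ((le_abs_self _).trans (abs_mul _ _).le)

lemma integrable_prod (i j : ι) :
    Integrable (fun p : ℝ × ℝ => S.φ i p.1 * S.f p.1 p.2 * S.ψ j p.2) := by
  refine ((S.integrable_φ i).mul_prod (S.integrable_ψ j)).mono ?_ (.of_forall fun p => ?_)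
  · exact ((((S.measurable_φ i).comp measurable_fst).mul S.measurable_f).mul
      ((S.measurable_ψ j).comp measurable_snd)).aestronglyMeasurable
  · simp only [Real.norm_eq_abs, abs_mul]
    have := S.abs_f_le_abs p.1 p.2
    calc |S.φ i p.1| * |S.f p.1 p.2| * |S.ψ j p.2|
        ≤ |S.φ i p.1| * (|S.u p.1| * |S.v p.2|) * |S.ψ j p.2| := by gcongr
      _ = _ := by ring

lemma integrable_φ_mul_f (i : ι) (y : ℝ) : Integrable fun x => S.φ i x * S.f x y := by
  refine ((S.integrable_φ i).mul_const (S.v y)).mono ?_ (.of_forall fun x => ?_)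
  · exact ((S.measurable_φ i).mul
      (S.measurable_f.comp (measurable_id.prodMk measurable_const))).aestronglyMeasurable
  · simp only [Real.norm_eq_abs, abs_mul, mul_assoc]
    gcongr
    exact S.abs_f_le_abs x y

lemma integrable_f_mul_ψ (i : ι) (x : ℝ) : Integrable fun y => S.f x y * S.ψ i y := by
  refine ((S.integrable_ψ i).const_mul (S.u x)).mono ?_ (.of_forall fun y => ?_)
  · exact ((S.measurable_f.comp (measurable_const.prodMk measurable_id)).mul
      (S.measurable_ψ i)).aestronglyMeasurable
  · simp only [Real.norm_eq_abs, abs_mul]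
    calc |S.f x y| * |S.ψ i y| ≤ |S.u x| * |S.v y| * |S.ψ i y| := by
          gcongr; exact S.abs_f_le_abs x y
      _ = _ := by ring

lemma measurable_α (i : ι) : Measurable (S.α i) := by
  have h : StronglyMeasurable (Function.uncurry fun x y => S.f x y * S.ψ i y) :=
    (S.measurable_f.mul ((S.measurable_ψ i).comp measurable_snd)).stronglyMeasurable
  exact h.integral_prod_right.measurable

lemma measurable_β (i : ι) : Measurable (S.β i) := by
  have h : StronglyMeasurable (Function.uncurry fun x y => S.φ i x * S.f x y) :=
    (((S.measurable_φ i).comp measurable_fst).mul S.measurable_f).stronglyMeasurable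
  exact h.integral_prod_left.measurable

lemma integrable_φ_mul_α (i j : ι) : Integrable fun x => S.φ i x * S.α j x := by
  have := (S.integrable_prod i j).integral_prod_left
  simpa only [mul_assoc, integral_const_mul, α] using this

lemma integrable_β_mul_ψ (i j : ι) : Integrable fun y => S.β i y * S.ψ j y := by
  have := (S.integrable_prod i j).integral_prod_right
  simpa only [integral_mul_const, β] using this

lemma integral_β_mul_ψ (i j : ι) : ∫ y, S.β i y * S.ψ j y = if i = j then 1 else 0 :=
  S.biorthogonal i j

lemma integral_φ_mul_α (i j : ι) : ∫ x, S.φ i x * S.α j x = if i = j then 1 else 0 := by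
  rw [← S.integral_β_mul_ψ]
  have := integral_integral_swap (f := fun x y => S.φ i x * S.f x y * S.ψ j y)
    (S.integrable_prod i j)
  simp only [integral_mul_const] at this
  simpa only [mul_assoc, integral_const_mul, α, β] using this

/-- The function `φ` on odd points and `β` on even points. -/
noncomputable def U (i : ι) : ℝ ⊕ ℝ → ℝ := Sum.elim (S.φ i) (S.β i)

/-- The function `α` on odd points and `ψ` on even points. -/
noncomputable def V (i : ι) : ℝ ⊕ ℝ → ℝ := Sum.elim (S.α i) (S.ψ i)

/-- The function `f(x, y)` at the pair of the even point `y` and the odd point `x`. -/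
def N : ℝ ⊕ ℝ → ℝ ⊕ ℝ → ℝ
  | .inr y, .inl x => S.f x y
  | _, _ => 0

lemma integrable_φ_mul_N (i : ι) (a : ℝ ⊕ ℝ) : Integrable fun t => S.φ i t * S.N a (.inl t) := by
  rcases a with x | y
  · simp [N]
  · exact S.integrable_φ_mul_f i y

lemma integrable_N_mul_ψ (i : ι) (b : ℝ ⊕ ℝ) : Integrable fun t => S.N (.inr t) b * S.ψ i t := by
  rcases b with x | y
  · exact S.integrable_f_mul_ψ i x
  · simp [N]

variable [Fintype ι]

/-- The correlation kernel. -/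
noncomputable def K (a b : ℝ ⊕ ℝ) : ℝ := ∑ i, S.U i a * S.V i b - S.N a b

/-- The determinant of the correlation kernel. -/
noncomputable def corr {κ : Type*} [Fintype κ] (p : κ → ℝ ⊕ ℝ) : ℝ :=
  open Classical in (Matrix.of fun j l => S.K (p j) (p l)).det

lemma corr_eq_det {κ : Type*} [Fintype κ] [DecidableEq κ] (p : κ → ℝ ⊕ ℝ) :
    S.corr p = (Matrix.of fun j l => S.K (p j) (p l)).det := by
  unfold corr
  congr!

lemma corr_comp_equiv {κ κ' : Type*} [Fintype κ] [Fintype κ'] (p : κ → ℝ ⊕ ℝ) (e : κ' ≃ κ) :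
    S.corr (p ∘ e) = S.corr p := by
  classical
  exact Matrix.det_submatrix_equiv_self e (Matrix.of fun j l => S.K (p j) (p l))

lemma φ_mul_K_inl (i : ι) (a : ℝ ⊕ ℝ) (t : ℝ) : S.φ i t * S.K a (.inl t) =
    ∑ j, S.U j a * (S.φ i t * S.α j t) - S.φ i t * S.N a (.inl t) := by
  simp only [K, mul_sub, Finset.mul_sum, V, Sum.elim_inl]
  congr 1
  exact Finset.sum_congr rfl fun j _ => by ring

lemma K_inr_mul_ψ (i : ι) (b : ℝ ⊕ ℝ) (t : ℝ) : S.K (.inr t) b * S.ψ i t =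
    ∑ j, S.V j b * (S.β j t * S.ψ i t) - S.N (.inr t) b * S.ψ i t := by
  simp only [K, sub_mul, Finset.sum_mul, U, Sum.elim_inr]
  congr 1
  exact Finset.sum_congr rfl fun j _ => by ring

lemma integrable_φ_mul_K (i : ι) (a : ℝ ⊕ ℝ) : Integrable fun t => S.φ i t * S.K a (.inl t) := by
  simp only [φ_mul_K_inl]
  exact (integrable_finsetSum _ fun j _ => (S.integrable_φ_mul_α i j).const_mul _).sub
    (S.integrable_φ_mul_N i a)

lemma integrable_K_mul_ψ (i : ι) (b : ℝ ⊕ ℝ) : Integrable fun t => S.K (.inr t) b * S.ψ i t := by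
  simp only [K_inr_mul_ψ]
  exact (integrable_finsetSum _ fun j _ => (S.integrable_β_mul_ψ j i).const_mul _).sub
    (S.integrable_N_mul_ψ i b)

/-- The sum collapses to `U i a` by biorthogonality. At an odd point `N` contributes nothing; at an
even point the subtracted term integrates to `β i`, which is `U i` there, and the two cancel. -/
lemma integral_φ_mul_K (i : ι) (a : ℝ ⊕ ℝ) :
    ∫ t, S.φ i t * S.K a (.inl t) = if a.isLeft then S.U i a else 0 := by
  simp only [φ_mul_K_inl]
  rw [integral_sub (integrable_finsetSum _ fun j _ => (S.integrable_φ_mul_α i j).const_mul _)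
    (S.integrable_φ_mul_N i a),
    integral_finsetSum _ fun j _ => (S.integrable_φ_mul_α i j).const_mul _]
  simp only [integral_const_mul, integral_φ_mul_α]
  rcases a with x | y <;> simp [N, U, β]

lemma integral_K_mul_ψ (i : ι) (b : ℝ ⊕ ℝ) :
    ∫ t, S.K (.inr t) b * S.ψ i t = if b.isRight then S.V i b else 0 := by
  simp only [K_inr_mul_ψ]
  rw [integral_sub (integrable_finsetSum _ fun j _ => (S.integrable_β_mul_ψ j i).const_mul _)
    (S.integrable_N_mul_ψ i b),
    integral_finsetSum _ fun j _ => (S.integrable_β_mul_ψ j i).const_mul _]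
  simp only [integral_const_mul, integral_β_mul_ψ]
  rcases b with x | y <;> simp [N, V, α]

lemma K_inl (x : ℝ) (b : ℝ ⊕ ℝ) : S.K (.inl x) b = ∑ i, S.φ i x * S.V i b := by
  simp [K, N, U]

lemma K_inr (a : ℝ ⊕ ℝ) (y : ℝ) : S.K a (.inr y) = ∑ i, S.U i a * S.ψ i y := by
  rcases a with a | a <;> simp [K, N, V]

/-- Half of a reproducing property. As `N` vanishes when its first argument is odd, `K (.inl t) b`
is a combination of the `φ i t`, and `integral_φ_mul_K` applies term by term. -/
lemma hasIntegral_K_inl_mul_K (a b : ℝ ⊕ ℝ) :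
    Integrable (fun t => S.K (.inl t) b * S.K a (.inl t)) ∧
      ∫ t, S.K (.inl t) b * S.K a (.inl t) = if a.isLeft then S.K a b else 0 := by
  have h : ∀ t, S.K (.inl t) b * S.K a (.inl t) =
      ∑ i, S.V i b * (S.φ i t * S.K a (.inl t)) := fun t => by
    rw [K_inl, Finset.sum_mul]
    exact Finset.sum_congr rfl fun i _ => by ring
  simp only [h]
  refine ⟨integrable_finsetSum _ fun i _ => (S.integrable_φ_mul_K i a).const_mul _, ?_⟩
  rw [integral_finsetSum _ fun i _ => (S.integrable_φ_mul_K i a).const_mul _]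
  simp only [integral_const_mul, integral_φ_mul_K]
  rcases a with x | y
  · simp [K_inl, U, mul_comm]
  · simp

/-- The dual half: `N` vanishes when its second argument is even, so here the type of `b`, not that
of `a`, decides. -/
lemma hasIntegral_K_inr_mul_K (a b : ℝ ⊕ ℝ) :
    Integrable (fun t => S.K (.inr t) b * S.K a (.inr t)) ∧
      ∫ t, S.K (.inr t) b * S.K a (.inr t) = if b.isRight then S.K a b else 0 := by
  have h : ∀ t, S.K (.inr t) b * S.K a (.inr t) =
      ∑ i, S.U i a * (S.K (.inr t) b * S.ψ i t) := fun t => by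
    rw [K_inr, Finset.mul_sum]
    exact Finset.sum_congr rfl fun i _ => by ring
  simp only [h]
  refine ⟨integrable_finsetSum _ fun i _ => (S.integrable_K_mul_ψ i b).const_mul _, ?_⟩
  rw [integral_finsetSum _ fun i _ => (S.integrable_K_mul_ψ i b).const_mul _]
  simp only [integral_const_mul, integral_K_mul_ψ]
  rcases b with x | y
  · simp
  · simp [K_inr, V]

lemma hasIntegral_K_inl_inl : Integrable (fun t => S.K (.inl t) (.inl t)) ∧
    ∫ t, S.K (.inl t) (.inl t) = Fintype.card ι := by
  simp only [K_inl, V, Sum.elim_inl]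
  refine ⟨integrable_finsetSum _ fun i _ => S.integrable_φ_mul_α i i, ?_⟩
  rw [integral_finsetSum _ fun i _ => S.integrable_φ_mul_α i i]
  simp [integral_φ_mul_α]

lemma hasIntegral_K_inr_inr : Integrable (fun t => S.K (.inr t) (.inr t)) ∧
    ∫ t, S.K (.inr t) (.inr t) = Fintype.card ι := by
  simp only [K_inr, U, Sum.elim_inr]
  refine ⟨integrable_finsetSum _ fun i _ => S.integrable_β_mul_ψ i i, ?_⟩
  rw [integral_finsetSum _ fun i _ => S.integrable_β_mul_ψ i i]
  simp [integral_β_mul_ψ]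

/-! ### Integrating one point out of the determinant -/

variable {κ : Type*} [Fintype κ]

/-- Expanding along the border isolates the new point `a`: it enters only through `K a a` and
through products of two kernel values, whose integrals are known. -/
lemma corr_border [DecidableEq κ] (p : κ → ℝ ⊕ ℝ) (a : ℝ ⊕ ℝ) :
    S.corr (Sum.elim p fun _ : Unit => a) = S.K a a * S.corr p -
      ∑ l, ∑ j, (Matrix.of fun j l => S.K (p j) (p l)).adjugate l j *
        (S.K a (p l) * S.K (p j) a) := by
  have h := det_fromBlocks_border (Matrix.of fun j l => S.K (p j) (p l)) (fun j => S.K (p j) a)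
    (fun l => S.K a (p l)) (S.K a a)
  have e : Matrix.fromBlocks (Matrix.of fun j l => S.K (p j) (p l))
      (Matrix.replicateCol Unit fun j => S.K (p j) a)
      (Matrix.replicateRow Unit fun l => S.K a (p l)) (Matrix.of fun _ _ => S.K a a) =
      Matrix.of fun j l => S.K (Sum.elim p (fun _ : Unit => a) j)
        (Sum.elim p (fun _ : Unit => a) l) := by
    ext j l
    rcases j with j | j <;> rcases l with l | l <;> rfl
  rw [S.corr_eq_det, S.corr_eq_det, ← e, h]
  congr 1
  simp only [dotProduct, Matrix.mulVec, Finset.mul_sum]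
  refine Finset.sum_congr rfl fun l _ => ?_
  refine Finset.sum_congr rfl fun j _ => ?_
  ring

/-- Common part of the odd and the even case: `τ` embeds the line as points of one species, and `M`
is whatever the composition of the kernel with itself over that species yields. -/
lemma hasIntegral_corr_of {τ : ℝ → ℝ ⊕ ℝ} {M : ℝ ⊕ ℝ → ℝ ⊕ ℝ → ℝ} {c : ℝ}
    (h1 : Integrable (fun t => S.K (τ t) (τ t)) ∧ ∫ t, S.K (τ t) (τ t) = c)
    (h2 : ∀ a b, Integrable (fun t => S.K (τ t) b * S.K a (τ t)) ∧
      ∫ t, S.K (τ t) b * S.K a (τ t) = M a b) [DecidableEq κ] (p : κ → ℝ ⊕ ℝ) :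
    Integrable (fun t => S.corr (Sum.elim p fun _ : Unit => τ t)) ∧
    ∫ t, S.corr (Sum.elim p fun _ : Unit => τ t) = c * S.corr p -
      ∑ l, ∑ j, (Matrix.of fun j l => S.K (p j) (p l)).adjugate l j * M (p j) (p l) := by
  have h3 := fun t => S.corr_border p (τ t)
  rw [show (fun t => S.corr (Sum.elim p fun _ : Unit => τ t)) = _ from funext h3]
  have i1 := h1.1.mul_const (S.corr p)
  have i2 : ∀ l j, Integrable fun t => (Matrix.of fun j l => S.K (p j) (p l)).adjugate l j *
      (S.K (τ t) (p l) * S.K (p j) (τ t)) := fun l j => ((h2 _ _).1).const_mul _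
  have i3 : ∀ l, Integrable fun t => ∑ j, (Matrix.of fun j l => S.K (p j) (p l)).adjugate l j *
      (S.K (τ t) (p l) * S.K (p j) (τ t)) := fun l => integrable_finsetSum _ fun j _ => i2 l j
  have i4 := integrable_finsetSum Finset.univ fun l _ => i3 l
  refine ⟨i1.sub i4, ?_⟩
  rw [integral_sub i1 i4, integral_mul_const, h1.2, integral_finsetSum _ fun l _ => i3 l]
  congr 1
  refine Finset.sum_congr rfl fun l _ => ?_
  rw [integral_finsetSum _ fun j _ => i2 l j]
  simp only [integral_const_mul, (h2 _ _).2]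

/-- Integration over an odd point. -/
lemma hasIntegral_corr_inl (p : κ → ℝ ⊕ ℝ) :
    Integrable (fun t => S.corr (Sum.elim p fun _ : Unit => .inl t)) ∧
    ∫ t, S.corr (Sum.elim p fun _ : Unit => .inl t) =
      (Fintype.card ι - (Finset.univ.filter fun j => (p j).isLeft).card) * S.corr p := by
  classical
  have h := S.hasIntegral_corr_of S.hasIntegral_K_inl_inl S.hasIntegral_K_inl_mul_K p
  refine ⟨h.1, h.2.trans ?_⟩
  rw [sub_mul]
  congr 1
  rw [Finset.sum_comm]
  -- For an odd point `j` the inner sum is a diagonal entry of the matrix times its adjugate, that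
  -- is, the determinant. Each odd point already present therefore lowers the factor by one.
  have : ∀ j, ∑ l, (Matrix.of fun j l => S.K (p j) (p l)).adjugate l j *
      (if (p j).isLeft then S.K (p j) (p l) else 0) = if (p j).isLeft then S.corr p else 0 := by
    intro j
    split_ifs
    · have := congrFun (congrFun (Matrix.mul_adjugate
        (Matrix.of fun j l => S.K (p j) (p l))) j) j
      rw [Matrix.mul_apply, Matrix.smul_apply, Matrix.one_apply_eq, smul_eq_mul, mul_one] at this
      unfold corr
      convert this using 1
      exact Finset.sum_congr rfl fun l _ => mul_comm _ _
    · simp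
  rw [Finset.sum_congr rfl fun j _ => this j, Finset.sum_ite]
  simp

/-- Integration over an even point. -/
lemma hasIntegral_corr_inr (p : κ → ℝ ⊕ ℝ) :
    Integrable (fun t => S.corr (Sum.elim p fun _ : Unit => .inr t)) ∧
    ∫ t, S.corr (Sum.elim p fun _ : Unit => .inr t) =
      (Fintype.card ι - (Finset.univ.filter fun j => (p j).isRight).card) * S.corr p := by
  classical
  have h := S.hasIntegral_corr_of S.hasIntegral_K_inr_inr S.hasIntegral_K_inr_mul_K p
  refine ⟨h.1, h.2.trans ?_⟩
  rw [sub_mul]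
  congr 1
  -- Here the condition is on the column index, so the adjugate stands on the left.
  have : ∀ l, ∑ j, (Matrix.of fun j l => S.K (p j) (p l)).adjugate l j *
      (if (p l).isRight then S.K (p j) (p l) else 0) = if (p l).isRight then S.corr p else 0 := by
    intro l
    split_ifs
    · have := congrFun (congrFun (Matrix.adjugate_mul
        (Matrix.of fun j l => S.K (p j) (p l))) l) l
      rw [Matrix.mul_apply, Matrix.smul_apply, Matrix.one_apply_eq, smul_eq_mul, mul_one] at this
      unfold corr
      exact this
    · simp
  rw [Finset.sum_congr rfl fun j _ => this j, Finset.sum_ite]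
  simp

end BiorthogonalSystem

/-- Iterated integration of a symmetric family of functions, each of which is up to a factor the
marginal of the next one. -/
lemma lintegral_sumElim {n : ℕ} (G : ∀ (κ : Type) [Fintype κ], (κ → ℝ) → ℝ)
    (hmeas : ∀ (κ : Type) [Fintype κ], Measurable (G κ))
    (hequiv : ∀ (κ κ' : Type) [Fintype κ] [Fintype κ'] (e : κ' ≃ κ) (x : κ → ℝ),
      G κ' (x ∘ e) = G κ x)
    (hnonneg : ∀ (κ : Type) [Fintype κ] (x : κ → ℝ), Fintype.card κ ≤ n → 0 ≤ G κ x)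
    (hstep : ∀ (κ : Type) [Fintype κ] (x : κ → ℝ),
      Integrable (fun t => G (κ ⊕ Unit) (Sum.elim x fun _ => t)) ∧
      ∫ t, G (κ ⊕ Unit) (Sum.elim x fun _ => t) = (n - Fintype.card κ) * G κ x) (m : ℕ) :
    ∀ (κ : Type) [Fintype κ] (x : κ → ℝ), Fintype.card κ + m = n →
      ∫⁻ s : Fin m → ℝ, ENNReal.ofReal (G (κ ⊕ Fin m) (Sum.elim x s)) =
        m.factorial * ENNReal.ofReal (G κ x) := by
  induction m with
  | zero =>
    intro κ _ x _
    have : ∀ s : Fin 0 → ℝ, G (κ ⊕ Fin 0) (Sum.elim x s) = G κ x := by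
      intro s
      rw [← hequiv κ (κ ⊕ Fin 0) (Equiv.sumEmpty κ (Fin 0)) x]
      congr 1
      ext (i | i)
      · rfl
      · exact i.elim0
    simp only [this]
    rw [volume_pi, Measure.pi_of_empty]
    simp
  | succ m ih =>
    intro κ _ x hκ
    have hmp := (volume_preserving_piFinSuccAbove (fun _ : Fin (m + 1) => ℝ) 0).symm
    have hm1 : Measurable fun s : Fin (m + 1) → ℝ =>
        ENNReal.ofReal (G (κ ⊕ Fin (m + 1)) (Sum.elim x s)) := by
      refine ((hmeas _).comp ?_).ennreal_ofReal
      refine measurable_pi_iff.2 fun i => ?_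
      rcases i with i | i
      · exact measurable_const
      · exact measurable_pi_apply i
    rw [← hmp.lintegral_comp hm1]
    rw [Measure.volume_eq_prod, lintegral_prod _ (by exact (hm1.comp hmp.measurable).aemeasurable)]
    have hG : ∀ (t : ℝ) (s : Fin m → ℝ), G (κ ⊕ Fin (m + 1))
        (Sum.elim x ((MeasurableEquiv.piFinSuccAbove (fun _ => ℝ) 0).symm (t, s))) =
        G ((κ ⊕ Unit) ⊕ Fin m) (Sum.elim (Sum.elim x fun _ => t) s) := by
      intro t s
      -- The coordinate `0` split off from `Fin (m + 1)` becomes the extra `Unit` point and the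
      -- remaining ones are shifted; invariance of `G` under relabelling absorbs this.
      rw [← hequiv _ _ ((Equiv.sumCongr (Equiv.refl κ) ((finSuccEquiv m).trans
        ((Equiv.optionEquivSumPUnit (Fin m)).trans (Equiv.sumComm _ _)))).trans
        (Equiv.sumAssoc κ Unit (Fin m)).symm)]
      congr 1
      ext (i | i)
      · rfl
      · refine Fin.cases ?_ (fun i => ?_) i
        · simp [MeasurableEquiv.piFinSuccAbove, Fin.insertNthEquiv]
        · simp [MeasurableEquiv.piFinSuccAbove, Fin.insertNthEquiv]
    have hcard : Fintype.card (κ ⊕ Unit) + m = n := by simp; omega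
    simp only [hG]
    have h2 := fun t : ℝ => ih (κ ⊕ Unit) (Sum.elim x fun _ => t) hcard
    simp only [h2]
    -- Only this one-variable Bochner integral is used. Its factor `n - card κ` equals `m + 1`, so
    -- the factors accumulate to `(m + 1)!`.
    have hs := hstep κ x
    rw [lintegral_const_mul' _ _ (ENNReal.natCast_ne_top _),
      ← ofReal_integral_eq_lintegral_ofReal hs.1
        (.of_forall fun t => hnonneg _ _ (by omega)), hs.2,
      show ((n : ℝ) - Fintype.card κ) = ((m + 1 : ℕ) : ℝ) by rw [← hκ]; push_cast; ring,
      ENNReal.ofReal_mul (by positivity), ENNReal.ofReal_natCast, ← mul_assoc,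
      Nat.factorial_succ, Nat.cast_mul, mul_comm (m.factorial : ENNReal)]

/-! ### Determinants at finitely many odd and even points -/

namespace BiorthogonalSystem

variable {ι : Type*} [DecidableEq ι] [Fintype ι] (S : BiorthogonalSystem ι)

/-- The determinant of the correlation kernel at odd points `x` and even points `y`. -/
noncomputable def D {κ₁ κ₂ : Type*} [Fintype κ₁] [Fintype κ₂] (x : κ₁ → ℝ) (y : κ₂ → ℝ) : ℝ :=
  S.corr (Sum.elim (fun i => .inl (x i)) (fun j => .inr (y j)))

lemma corr_eq_of_equiv {κ κ' : Type*} [Fintype κ] [Fintype κ'] {p : κ → ℝ ⊕ ℝ} {q : κ' → ℝ ⊕ ℝ}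
    (e : κ' ≃ κ) (h : ∀ j, q j = p (e j)) : S.corr q = S.corr p := by
  rw [← S.corr_comp_equiv p e]
  congr 1
  exact funext h

section

variable {κ₁ κ₂ : Type*} [Fintype κ₁] [Fintype κ₂]

lemma D_comp_equiv {κ₁' κ₂' : Type*} [Fintype κ₁'] [Fintype κ₂'] (x : κ₁ → ℝ) (y : κ₂ → ℝ)
    (e₁ : κ₁' ≃ κ₁) (e₂ : κ₂' ≃ κ₂) : S.D (x ∘ e₁) (y ∘ e₂) = S.D x y :=
  S.corr_eq_of_equiv (Equiv.sumCongr e₁ e₂) (by rintro (i | i) <;> rfl)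

lemma hasIntegral_D_odd (x : κ₁ → ℝ) (y : κ₂ → ℝ) :
    Integrable (fun t => S.D (Sum.elim x fun _ : Unit => t) y) ∧
    ∫ t, S.D (Sum.elim x fun _ : Unit => t) y =
      (Fintype.card ι - Fintype.card κ₁) * S.D x y := by
  have h := S.hasIntegral_corr_inl (Sum.elim (fun i => .inl (x i)) (fun j => .inr (y j)))
  have hD : ∀ t, S.D (Sum.elim x fun _ : Unit => t) y = S.corr (Sum.elim
      (Sum.elim (fun i => .inl (x i)) (fun j => .inr (y j))) fun _ : Unit => .inl t) := fun t =>
    S.corr_eq_of_equiv ((Equiv.sumAssoc _ _ _).trans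
      ((Equiv.sumCongr (Equiv.refl _) (Equiv.sumComm _ _)).trans (Equiv.sumAssoc _ _ _).symm))
      (by rintro ((i | i) | i) <;> rfl)
  simp only [hD]
  refine ⟨h.1, h.2.trans ?_⟩
  congr 3
  rw [Finset.card_filter, Fintype.sum_sum_type]
  simp

lemma hasIntegral_D_even (x : κ₁ → ℝ) (y : κ₂ → ℝ) :
    Integrable (fun t => S.D x (Sum.elim y fun _ : Unit => t)) ∧
    ∫ t, S.D x (Sum.elim y fun _ : Unit => t) =
      (Fintype.card ι - Fintype.card κ₂) * S.D x y := by
  have h := S.hasIntegral_corr_inr (Sum.elim (fun i => .inl (x i)) (fun j => .inr (y j)))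
  have hD : ∀ t, S.D x (Sum.elim y fun _ : Unit => t) = S.corr (Sum.elim
      (Sum.elim (fun i => .inl (x i)) (fun j => .inr (y j))) fun _ : Unit => .inr t) := fun t =>
    S.corr_eq_of_equiv (Equiv.sumAssoc _ _ _).symm (by rintro (i | (i | i)) <;> rfl)
  simp only [hD]
  refine ⟨h.1, h.2.trans ?_⟩
  congr 3
  rw [Finset.card_filter, Fintype.sum_sum_type]
  simp

lemma measurable_D {Ω : Type*} [MeasurableSpace Ω] {x : Ω → κ₁ → ℝ} {y : Ω → κ₂ → ℝ}
    (hx : Measurable x) (hy : Measurable y) : Measurable fun ω => S.D (x ω) (y ω) := by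
  classical
  have hU : ∀ i j, Measurable fun ω => S.U i
      (Sum.elim (fun i => .inl (x ω i)) (fun j => .inr (y ω j)) j) := by
    rintro i (j | j)
    · exact (S.measurable_φ i).comp ((measurable_pi_apply j).comp hx)
    · exact (S.measurable_β i).comp ((measurable_pi_apply j).comp hy)
  have hV : ∀ i j, Measurable fun ω => S.V i
      (Sum.elim (fun i => .inl (x ω i)) (fun j => .inr (y ω j)) j) := by
    rintro i (j | j)
    · exact (S.measurable_α i).comp ((measurable_pi_apply j).comp hx)
    · exact (S.measurable_ψ i).comp ((measurable_pi_apply j).comp hy)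
  have hN : ∀ j l, Measurable fun ω => S.N
      (Sum.elim (fun i => .inl (x ω i)) (fun j => .inr (y ω j)) j)
      (Sum.elim (fun i => .inl (x ω i)) (fun j => .inr (y ω j)) l) := by
    rintro (j | j) (l | l)
    · exact measurable_const
    · exact measurable_const
    · exact S.measurable_f.comp (((measurable_pi_apply l).comp hx).prodMk
        ((measurable_pi_apply j).comp hy))
    · exact measurable_const
  unfold D
  simp only [corr_eq_det, Matrix.det_apply]
  refine Finset.measurable_fun_sum _ fun σ _ => Measurable.const_smul ?_ _
  refine Finset.measurable_fun_prod _ fun j _ => ?_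
  exact (Finset.measurable_fun_sum _ fun i _ => (hU i _).mul (hV i _)).sub (hN _ _)

/-- The determinant of the kernel at `n` odd and `n` even points. -/
lemma D_eq_mul (x y : ι → ℝ) : S.D x y = (Matrix.of fun j i => S.φ i (x j)).det *
    (Matrix.of fun j l => S.f (x j) (y l)).det * (Matrix.of fun j i => S.ψ i (y j)).det := by
  have h := det_fromBlocks_chain (Matrix.of fun j i => S.φ i (x j))
    (Matrix.of fun j l => S.f (x l) (y j)) (Matrix.of fun i j => S.ψ i (y j))
    (Matrix.of fun j i => S.β i (y j)) (Matrix.of fun i j => S.α i (x j))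
  rw [← Matrix.det_transpose (Matrix.of fun j l => S.f (x l) (y j)),
    ← Matrix.det_transpose (Matrix.of fun i j => S.ψ i (y j))] at h
  refine Eq.trans ?_ h
  rw [D, corr_eq_det]
  congr 1
  ext (i | i) (j | j) <;> simp [K, N, U, V, Matrix.mul_apply]

end

variable {S} in
-- Induction on the number `m` of missing points: as long as a species is incomplete, `D` is a
-- positive multiple inverse of `n - k` times the integral of a nonnegative determinant with one
-- more point.
lemma D_nonneg (h : ∀ x y : ι → ℝ, 0 ≤ S.D x y) (m : ℕ) : ∀ {κ₁ κ₂ : Type} [Fintype κ₁]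
    [Fintype κ₂] (x : κ₁ → ℝ) (y : κ₂ → ℝ), Fintype.card κ₁ ≤ Fintype.card ι →
    Fintype.card κ₂ ≤ Fintype.card ι →
    2 * Fintype.card ι = Fintype.card κ₁ + Fintype.card κ₂ + m → 0 ≤ S.D x y := by
  induction m with
  | zero =>
    intro κ₁ κ₂ _ _ x y h1 h2 h3
    rw [← S.D_comp_equiv x y (Fintype.equivOfCardEq (α := ι) (by omega))
      (Fintype.equivOfCardEq (α := ι) (by omega))]
    exact h _ _
  | succ m ih =>
    intro κ₁ κ₂ _ _ x y h1 h2 h3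
    rcases h1.lt_or_eq with h1' | h1'
    · have hpos : (0 : ℝ) < Fintype.card ι - Fintype.card κ₁ := by
        rw [sub_pos]; exact_mod_cast h1'
      have h4 : 0 ≤ ∫ t, S.D (Sum.elim x fun _ : Unit => t) y := integral_nonneg fun t =>
        ih _ _ (by simp; omega) h2 (by simp; omega)
      rw [(S.hasIntegral_D_odd x y).2] at h4
      exact nonneg_of_mul_nonneg_right h4 hpos
    · have hpos : (0 : ℝ) < Fintype.card ι - Fintype.card κ₂ := by
        rw [sub_pos]; exact_mod_cast (by omega)
      have h4 : 0 ≤ ∫ t, S.D x (Sum.elim y fun _ : Unit => t) := integral_nonneg fun t =>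
        ih _ _ h1 (by simp; omega) (by simp; omega)
      rw [(S.hasIntegral_D_even x y).2] at h4
      exact nonneg_of_mul_nonneg_right h4 hpos

variable {S} in
-- Tonelli: the even variables are integrated out first, then the odd ones, each by
-- `lintegral_sumElim`. Nonnegativity of the intermediate determinants comes from `D_nonneg`.
lemma lintegral_D (h : ∀ x y : ι → ℝ, 0 ≤ S.D x y) {κ₁ κ₂ : Type} [Fintype κ₁] [Fintype κ₂]
    (x : κ₁ → ℝ) (y : κ₂ → ℝ) {m₁ m₂ : ℕ} (h₁ : Fintype.card κ₁ + m₁ = Fintype.card ι)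
    (h₂ : Fintype.card κ₂ + m₂ = Fintype.card ι) :
    ∫⁻ st : (Fin m₁ → ℝ) × (Fin m₂ → ℝ),
      ENNReal.ofReal (S.D (Sum.elim x st.1) (Sum.elim y st.2)) =
        m₁.factorial * m₂.factorial * ENNReal.ofReal (S.D x y) := by
  have hnn : ∀ {κ₁ κ₂ : Type} [Fintype κ₁] [Fintype κ₂] (x : κ₁ → ℝ) (y : κ₂ → ℝ),
      Fintype.card κ₁ ≤ Fintype.card ι → Fintype.card κ₂ ≤ Fintype.card ι → 0 ≤ S.D x y :=
    fun {κ₁ κ₂} _ _ x y h1 h2 => D_nonneg h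
      (2 * Fintype.card ι - (Fintype.card κ₁ + Fintype.card κ₂)) x y h1 h2 (by omega)
  have hmeas : Measurable fun st : (Fin m₁ → ℝ) × (Fin m₂ → ℝ) =>
      ENNReal.ofReal (S.D (Sum.elim x st.1) (Sum.elim y st.2)) := by
    refine (S.measurable_D ?_ ?_).ennreal_ofReal
    · refine measurable_pi_iff.2 ?_
      rintro (i | i)
      · exact measurable_const
      · exact (measurable_pi_apply i).comp measurable_fst
    · refine measurable_pi_iff.2 ?_
      rintro (i | i)
      · exact measurable_const
      · exact (measurable_pi_apply i).comp measurable_snd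
  rw [Measure.volume_eq_prod, lintegral_prod _ hmeas.aemeasurable]
  have hin : ∀ s : Fin m₁ → ℝ, ∫⁻ t : Fin m₂ → ℝ,
      ENNReal.ofReal (S.D (Sum.elim x s) (Sum.elim y t)) =
        m₂.factorial * ENNReal.ofReal (S.D (Sum.elim x s) y) := fun s =>
    lintegral_sumElim (fun κ _ y => S.D (Sum.elim x s) y)
      (fun κ _ => S.measurable_D measurable_const measurable_id)
      (fun κ κ' _ _ e y => S.D_comp_equiv (Sum.elim x s) y (Equiv.refl _) e)
      (fun κ _ y hy => hnn _ _ (by simp; omega) hy)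
      (fun κ _ y => S.hasIntegral_D_even _ y) m₂ κ₂ y h₂
  have hout := lintegral_sumElim (fun κ _ x => S.D x y)
      (fun κ _ => S.measurable_D measurable_id measurable_const)
      (fun κ κ' _ _ e x => S.D_comp_equiv x y e (Equiv.refl _))
      (fun κ _ x hx => hnn _ _ hx (by omega))
      (fun κ _ x => S.hasIntegral_D_odd x y) m₁ κ₁ x h₁
  simp only [hin]
  rw [lintegral_const_mul' _ _ (ENNReal.natCast_ne_top _), hout]
  ring

end BiorthogonalSystem

/-! ### Interleaved configurations -/

/-- Splitting of the labels into odd and even ones. -/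
def parityEquiv (n : ℕ) : Fin n ⊕ Fin n ≃ Fin (2 * n) where
  toFun := Sum.elim oddPos evenPos
  invFun i := if (i : ℕ) % 2 = 0 then .inl ⟨i / 2, by omega⟩ else .inr ⟨i / 2, by omega⟩
  left_inv := by
    rintro (j | j)
    · simp [oddPos]
    · have h : ((Sum.elim oddPos evenPos (.inr j) : Fin (2 * n)) : ℕ) = 2 * j + 1 := rfl
      refine (if_neg (by rw [h]; omega)).trans ?_
      congr 1
      ext
      simp only [h]
      omega
  right_inv := by
    intro i
    by_cases h : (i : ℕ) % 2 = 0
    · simp only [h, if_true, Sum.elim_inl, oddPos]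
      ext
      simp only
      omega
    · simp only [h, if_false, Sum.elim_inr, evenPos]
      ext
      simp only
      omega

variable {n : ℕ}

@[simp] lemma interleave_oddPos (x y : Fin n → ℝ) (j : Fin n) : interleave x y (oddPos j) = x j := by
  simp [interleave, oddPos]

@[simp] lemma interleave_evenPos (x y : Fin n → ℝ) (j : Fin n) :
    interleave x y (evenPos j) = y j := by
  have h : (evenPos j : ℕ) = 2 * j + 1 := rfl
  rw [interleave, if_neg (by rw [h]; omega)]
  congr 1
  ext
  simp only [h]
  omega

lemma forall_fin_two_mul {P : Fin (2 * n) → Prop} :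
    (∀ i, P i) ↔ (∀ j, P (oddPos j)) ∧ ∀ j, P (evenPos j) := by
  rw [← (parityEquiv n).forall_congr_right]
  simp [parityEquiv]

lemma prod_fin_two_mul (f : Fin (2 * n) → ℝ) :
    ∏ i, f i = (∏ j, f (oddPos j)) * ∏ j, f (evenPos j) := by
  rw [← (parityEquiv n).prod_comp]
  simp [parityEquiv]

lemma strictAnti_of_strictAnti_interleave {x y : Fin n → ℝ} (h : StrictAnti (interleave x y)) :
    StrictAnti x ∧ StrictAnti y := by
  constructor
  · intro i j hij
    have := h (show oddPos i < oddPos j by simp only [oddPos, Fin.lt_def] at *; omega)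
    simpa using this
  · intro i j hij
    have := h (show evenPos i < evenPos j by simp only [evenPos, Fin.lt_def] at *; omega)
    simpa using this

/-- The indicator pattern gives `x j ≤ y i` for `i < j`; the absence of coincidences is what turns
this into a strict inequality. -/
lemma strictAnti_interleave_iff {x y : Fin n → ℝ} (hx : StrictAnti x) (hy : StrictAnti y)
    (hxy : ∀ i j, x i ≠ y j) :
    StrictAnti (interleave x y) ↔ ∀ j l, y l < x j ↔ j ≤ l := by
  constructor
  · intro h j l
    constructor
    · intro hl
      by_contra hjl
      have := h (show evenPos l < oddPos j by
        simp only [oddPos, evenPos, Fin.lt_def, Fin.le_def] at *; omega)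
      simp only [interleave_oddPos, interleave_evenPos] at this
      exact lt_asymm this hl
    · intro hjl
      have := h (show oddPos j < evenPos l by
        simp only [oddPos, evenPos, Fin.lt_def, Fin.le_def] at *; omega)
      simpa using this
  · intro h a b
    revert a b
    rw [forall_fin_two_mul]
    refine ⟨fun i => forall_fin_two_mul.2 ⟨fun j hij => ?_, fun j hij => ?_⟩,
      fun i => forall_fin_two_mul.2 ⟨fun j hij => ?_, fun j hij => ?_⟩⟩
    all_goals
      simp only [interleave_oddPos, interleave_evenPos]
      simp only [oddPos, evenPos, Fin.lt_def] at hij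
    · exact hx (Fin.lt_def.2 (by omega))
    · exact (h i j).2 (Fin.le_def.2 (by omega))
    · refine lt_of_le_of_ne (not_lt.1 fun hl => ?_) (hxy j i)
      have := Fin.le_def.1 ((h j i).1 hl)
      omega
    · exact hy (Fin.lt_def.2 (by omega))

lemma measurePreserving_interleave : MeasurePreserving
    (fun p : (Fin n → ℝ) × (Fin n → ℝ) => interleave p.1 p.2) := by
  have h := (volume_measurePreserving_piCongrLeft (fun _ : Fin (2 * n) => ℝ) (parityEquiv n)).comp
    (volume_measurePreserving_sumPiEquivProdPi_symm (fun _ : Fin n ⊕ Fin n => ℝ))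
  refine (congrArg (MeasurePreserving · volume volume) (funext fun p => funext fun i => ?_)).mpr h
  revert i
  rw [forall_fin_two_mul]
  constructor
  · intro j
    have := Equiv.piCongrLeft_apply_apply (P := fun _ : Fin (2 * n) => ℝ) (parityEquiv n)
      ((MeasurableEquiv.sumPiEquivProdPi (fun _ : Fin n ⊕ Fin n => ℝ)).symm p) (.inl j)
    simp only [interleave_oddPos]
    exact this.symm
  · intro j
    have := Equiv.piCongrLeft_apply_apply (P := fun _ : Fin (2 * n) => ℝ) (parityEquiv n)
      ((MeasurableEquiv.sumPiEquivProdPi (fun _ : Fin n ⊕ Fin n => ℝ)).symm p) (.inr j)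
    simp only [interleave_evenPos]
    exact this.symm

lemma measurePreserving_comp_perm (σ : Equiv.Perm (Fin n)) :
    MeasurePreserving (fun x : Fin n → ℝ => x ∘ σ) := by
  have h := volume_measurePreserving_piCongrLeft (fun _ : Fin n => ℝ) σ.symm
  refine (congrArg (MeasurePreserving · volume volume) (funext fun x => funext fun i => ?_)).mpr h
  have := Equiv.piCongrLeft_apply_apply (P := fun _ : Fin n => ℝ) σ.symm x (σ i)
  rw [Equiv.symm_apply_apply] at this
  exact this.symm

lemma exists_perm_strictAnti {x : Fin n → ℝ} (hx : Function.Injective x) :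
    ∃ σ : Equiv.Perm (Fin n), StrictAnti (x ∘ σ) := by
  refine ⟨Tuple.sort fun i => -x i, ?_⟩
  have h := Tuple.monotone_sort fun i => -x i
  refine Antitone.strictAnti_of_injective (fun i j hij => ?_) (hx.comp (Equiv.injective _))
  simpa using h hij

lemma perm_eq_of_strictAnti {x : Fin n → ℝ} {σ τ : Equiv.Perm (Fin n)} (hσ : StrictAnti (x ∘ σ))
    (hτ : StrictAnti (x ∘ τ)) : σ = τ := by
  have h := Tuple.unique_monotone (f := fun i => -x i) (σ := σ) (τ := τ)
    (fun i j hij => by simpa using hσ.antitone hij) (fun i j hij => by simpa using hτ.antitone hij)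
  have hx : Function.Injective x := by
    have := hσ.injective
    rwa [Equiv.injective_comp] at this
  ext i
  have := congrFun h i
  simp only [Function.comp_apply, neg_inj] at this
  rw [hx this]

/-- A coincidence involving an integration variable lies on a null hyperplane. Coincidences between
two fixed points are not removed by integration and have to be excluded by hypothesis. -/
lemma ae_ne_prod (m₁ m₂ : ℕ) {κ₁ κ₂ : Type} [Fintype κ₁] [Fintype κ₂] {x : κ₁ → ℝ} {y : κ₂ → ℝ}
    (hxy : ∀ i j, x i ≠ y j) : ∀ᵐ st : (Fin m₁ → ℝ) × (Fin m₂ → ℝ),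
      ∀ i j, (Sum.elim x st.1) i ≠ (Sum.elim y st.2) j := by
  simp only [ae_all_iff]
  have hfst : ∀ (j : Fin m₁) (c : ℝ), ∀ᵐ st : (Fin m₁ → ℝ) × (Fin m₂ → ℝ), st.1 j ≠ c := by
    intro j c
    exact Measure.quasiMeasurePreserving_fst.ae (Measure.ae_eval_ne (μ := fun _ => (volume : Measure ℝ)) j c)
  have hsnd : ∀ (j : Fin m₂) (c : ℝ), ∀ᵐ st : (Fin m₁ → ℝ) × (Fin m₂ → ℝ), st.2 j ≠ c := by
    intro j c
    exact Measure.quasiMeasurePreserving_snd.ae (Measure.ae_eval_ne (μ := fun _ => (volume : Measure ℝ)) j c)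
  rintro (i | i) (j | j)
  · exact .of_forall fun _ => hxy i j
  · filter_upwards [hsnd j (x i)] with st h using h.symm
  · exact hfst i (y j)
  · have hm : MeasurableSet {st : (Fin m₁ → ℝ) × (Fin m₂ → ℝ) | st.1 i = st.2 j} :=
      measurableSet_eq_fun ((measurable_pi_apply i).comp measurable_fst)
        ((measurable_pi_apply j).comp measurable_snd)
    have : volume {st : (Fin m₁ → ℝ) × (Fin m₂ → ℝ) | st.1 i = st.2 j} = 0 := by
      rw [Measure.volume_eq_prod, Measure.measure_prod_null hm]
      refine .of_forall fun s => ?_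
      have := Measure.pi_hyperplane (fun _ : Fin m₂ => (volume : Measure ℝ)) j (s i)
      simpa [eq_comm, volume_pi] using this
    rw [ae_iff]
    simpa using this

/-- The labels of the given and of the remaining coordinates. -/
def extendEquiv {n k : ℕ} (hk : k ≤ n) : Fin n ≃ Fin k ⊕ Fin (n - k) :=
  (finCongr (by omega : n = k + (n - k))).trans finSumFinEquiv.symm

lemma extend_eq {k : ℕ} (hk : k ≤ n) (x : Fin k → ℝ) (s : Fin (n - k) → ℝ) :
    extend x s = Sum.elim x s ∘ extendEquiv hk := by
  ext i
  obtain ⟨a, rfl⟩ := (extendEquiv hk).symm.surjective i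
  rw [Function.comp_apply, Equiv.apply_symm_apply]
  rcases a with a | a <;> simp [extend, extendEquiv]

/-! ### Correlations of a weight given by a biorthogonal system -/

section Correlation

variable (S : BiorthogonalSystem (Fin n)) {W : (Fin (2 * n) → ℝ) → ℝ} {c : ℝ}

/-- The sum over the relabellings of a weight, in terms of a biorthogonal system. -/
lemma sum_perm_weight (hsupp : ∀ z, ¬ StrictAnti z → W z = 0)
    (hW : ∀ x y : Fin n → ℝ, StrictAnti x → StrictAnti y → (∀ i j, x i ≠ y j) →
      S.D x y = c * W (interleave x y)) (x y : Fin n → ℝ) (hxy : ∀ i j, x i ≠ y j) :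
    S.D x y = c * ∑ σ : Equiv.Perm (Fin n), ∑ τ : Equiv.Perm (Fin n),
      W (interleave (x ∘ σ) (y ∘ τ)) := by
  by_cases hx : Function.Injective x
  · by_cases hy : Function.Injective y
    · obtain ⟨σ, hσ⟩ := exists_perm_strictAnti hx
      obtain ⟨τ, hτ⟩ := exists_perm_strictAnti hy
      -- Only the pair of permutations sorting `x` and `y` can give a decreasing interleaving, so a
      -- single term of the double sum survives.
      rw [Finset.sum_eq_single σ, Finset.sum_eq_single τ,
        ← hW _ _ hσ hτ (fun i j => hxy _ _), S.D_comp_equiv]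
      · intro τ' _ hne
        refine hsupp _ fun h => hne ?_
        exact perm_eq_of_strictAnti (strictAnti_of_strictAnti_interleave h).2 hτ
      · simp
      · intro σ' _ hne
        refine Finset.sum_eq_zero fun τ' _ => hsupp _ fun h => hne ?_
        exact perm_eq_of_strictAnti (strictAnti_of_strictAnti_interleave h).1 hσ
      · simp
    · rw [Finset.sum_eq_zero, mul_zero, S.D_eq_mul]
      · simp only [Function.Injective, not_forall] at hy
        obtain ⟨i, j, hij, hne⟩ := hy
        rw [Matrix.det_zero_of_row_eq (M := Matrix.of fun j i => S.ψ i (y j)) hne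
          (by ext l; simp [hij]), mul_zero]
      · refine fun σ _ => Finset.sum_eq_zero fun τ _ => hsupp _ fun h => hy ?_
        have := (strictAnti_of_strictAnti_interleave h).2.injective
        rwa [Equiv.injective_comp] at this
  · rw [Finset.sum_eq_zero, mul_zero, S.D_eq_mul]
    · simp only [Function.Injective, not_forall] at hx
      obtain ⟨i, j, hij, hne⟩ := hx
      rw [Matrix.det_zero_of_row_eq (M := Matrix.of fun j i => S.φ i (x j)) hne
        (by ext l; simp [hij]), zero_mul, zero_mul]
    · refine fun σ _ => Finset.sum_eq_zero fun τ _ => hsupp _ fun h => hx ?_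
      have := (strictAnti_of_strictAnti_interleave h).1.injective
      rwa [Equiv.injective_comp] at this

lemma lintegral_interleave_perm (hm : Measurable W) (σ τ : Equiv.Perm (Fin n)) :
    ∫⁻ p : (Fin n → ℝ) × (Fin n → ℝ), ENNReal.ofReal (W (interleave (p.1 ∘ σ) (p.2 ∘ τ))) =
      ∫⁻ z, ENNReal.ofReal (W z) :=
  (measurePreserving_interleave.comp
    ((measurePreserving_comp_perm σ).prod (measurePreserving_comp_perm τ))).lintegral_comp
      hm.ennreal_ofReal

variable {S}

lemma lintegral_D_extend (hD : ∀ x y : Fin n → ℝ, 0 ≤ S.D x y) {k₁ k₂ : ℕ} (h₁ : k₁ ≤ n)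
    (h₂ : k₂ ≤ n) (x : Fin k₁ → ℝ) (y : Fin k₂ → ℝ) :
    ∫⁻ st : (Fin (n - k₁) → ℝ) × (Fin (n - k₂) → ℝ),
      ENNReal.ofReal (S.D (extend x st.1) (extend y st.2)) =
      (n - k₁).factorial * (n - k₂).factorial * ENNReal.ofReal (S.D x y) := by
  rw [← BiorthogonalSystem.lintegral_D hD x y (m₁ := n - k₁) (m₂ := n - k₂) (by simp [h₁])
    (by simp [h₂])]
  simp only [extend_eq h₁, extend_eq h₂, S.D_comp_equiv]

lemma measurable_D_extend {k₁ k₂ : ℕ} (h₁ : k₁ ≤ n)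
    (h₂ : k₂ ≤ n) (x : Fin k₁ → ℝ) (y : Fin k₂ → ℝ) :
    Measurable fun st : (Fin (n - k₁) → ℝ) × (Fin (n - k₂) → ℝ) =>
      S.D (extend x st.1) (extend y st.2) := by
  simp only [extend_eq h₁, extend_eq h₂, S.D_comp_equiv]
  refine S.measurable_D ?_ ?_
  · refine measurable_pi_iff.2 ?_
    rintro (i | i)
    · exact measurable_const
    · exact (measurable_pi_apply i).comp measurable_fst
  · refine measurable_pi_iff.2 ?_
    rintro (i | i)
    · exact measurable_const
    · exact (measurable_pi_apply i).comp measurable_snd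

lemma ae_ne_extend {k₁ k₂ : ℕ} (h₁ : k₁ ≤ n) (h₂ : k₂ ≤ n) {x : Fin k₁ → ℝ} {y : Fin k₂ → ℝ}
    (hxy : ∀ i j, x i ≠ y j) : ∀ᵐ st : (Fin (n - k₁) → ℝ) × (Fin (n - k₂) → ℝ),
      ∀ i j, extend x st.1 i ≠ extend y st.2 j := by
  filter_upwards [ae_ne_prod (n - k₁) (n - k₂) hxy] with st hst i j
  rw [extend_eq h₁, extend_eq h₂]
  exact hst _ _

lemma D_elim0 (x y : Fin 0 → ℝ) : S.D x y = 1 := by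
  rw [BiorthogonalSystem.D, S.corr_eq_det, Matrix.det_isEmpty]

/-- Integrate out all points, starting from the empty determinant 1. The integral of `D` is then
`(n!)²`, and it is also `c` times the sum over `(n!)²` relabellings, each contributing the same
integral of `W`. Hence `c ∫ W = 1`. -/
lemma lintegral_weight (hc : 0 < c) (hm : Measurable W) (hpos : ∀ z, 0 ≤ W z)
    (hD : ∀ x y : Fin n → ℝ, 0 ≤ S.D x y)
    (hsum : ∀ x y : Fin n → ℝ, (∀ i j, x i ≠ y j) →
      S.D x y = c * ∑ σ : Equiv.Perm (Fin n), ∑ τ : Equiv.Perm (Fin n),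
        W (interleave (x ∘ σ) (y ∘ τ))) :
    ∫⁻ z, ENNReal.ofReal (W z) = ENNReal.ofReal c⁻¹ := by
  have h0 := BiorthogonalSystem.lintegral_D hD (Fin.elim0 : Fin 0 → ℝ) (Fin.elim0 : Fin 0 → ℝ)
    (m₁ := n) (m₂ := n) (by simp) (by simp)
  rw [D_elim0, ENNReal.ofReal_one, mul_one] at h0
  have h1 : ∫⁻ st : (Fin n → ℝ) × (Fin n → ℝ), ENNReal.ofReal
      (S.D (Sum.elim (Fin.elim0 : Fin 0 → ℝ) st.1) (Sum.elim (Fin.elim0 : Fin 0 → ℝ) st.2)) =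
      ∫⁻ st : (Fin n → ℝ) × (Fin n → ℝ), ∑ σ : Equiv.Perm (Fin n), ∑ τ : Equiv.Perm (Fin n),
        ENNReal.ofReal c * ENNReal.ofReal (W (interleave (st.1 ∘ σ) (st.2 ∘ τ))) := by
    refine lintegral_congr_ae ?_
    filter_upwards [ae_ne_prod n n (x := (Fin.elim0 : Fin 0 → ℝ)) (y := (Fin.elim0 : Fin 0 → ℝ))
      (fun i => i.elim0)] with st hst
    rw [← S.D_comp_equiv _ _ (Equiv.emptySum (Fin 0) (Fin n)).symm
      (Equiv.emptySum (Fin 0) (Fin n)).symm]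
    have := hsum st.1 st.2 fun i j => hst (.inr i) (.inr j)
    rw [show (Sum.elim Fin.elim0 st.1 ∘ (Equiv.emptySum (Fin 0) (Fin n)).symm) = st.1 from rfl,
      show (Sum.elim Fin.elim0 st.2 ∘ (Equiv.emptySum (Fin 0) (Fin n)).symm) = st.2 from rfl,
      this, Finset.mul_sum, ENNReal.ofReal_sum_of_nonneg]
    · refine Finset.sum_congr rfl fun σ _ => ?_
      rw [Finset.mul_sum, ENNReal.ofReal_sum_of_nonneg]
      · exact Finset.sum_congr rfl fun τ _ => ENNReal.ofReal_mul hc.le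
      · exact fun τ _ => mul_nonneg hc.le (hpos _)
    · exact fun σ _ => mul_nonneg hc.le (Finset.sum_nonneg fun τ _ => hpos _)
  have hmW : ∀ σ τ : Equiv.Perm (Fin n), Measurable fun st : (Fin n → ℝ) × (Fin n → ℝ) =>
      ENNReal.ofReal c * ENNReal.ofReal (W (interleave (st.1 ∘ σ) (st.2 ∘ τ))) := fun σ τ =>
    (hm.comp (measurePreserving_interleave.comp ((measurePreserving_comp_perm σ).prod
      (measurePreserving_comp_perm τ))).measurable).ennreal_ofReal.const_mul _
  rw [h1, lintegral_finsetSum _ fun σ _ => Finset.measurable_fun_sum _ fun τ _ => hmW σ τ] at h0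
  simp only [lintegral_finsetSum _ fun τ _ => hmW _ τ,
    lintegral_const_mul' _ _ ENNReal.ofReal_ne_top, lintegral_interleave_perm hm,
    Finset.sum_const, Finset.card_univ, Fintype.card_perm, Fintype.card_fin, nsmul_eq_mul] at h0
  have hf : (n.factorial : ENNReal) ≠ 0 := by exact_mod_cast n.factorial_ne_zero
  have hf' : (n.factorial : ENNReal) ≠ ⊤ := ENNReal.natCast_ne_top _
  have hc0 : ENNReal.ofReal c ≠ 0 := by simpa using hc
  rw [← mul_assoc, ← mul_assoc] at h0
  have h2 : ENNReal.ofReal c * ∫⁻ z, ENNReal.ofReal (W z) = 1 := by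
    rw [mul_assoc] at h0
    refine (ENNReal.mul_right_inj (mul_ne_zero hf hf) (ENNReal.mul_ne_top hf' hf')).1 ?_
    rw [h0, mul_one]
  rw [ENNReal.ofReal_inv_of_pos hc]
  exact ENNReal.eq_inv_of_mul_eq_one_left (by rwa [mul_comm])

/-- The correlations of a weight whose symmetrization is a biorthogonal system. -/
theorem correlation_eq_D (hc : 0 < c) (hm : Measurable W) (hpos : ∀ z, 0 ≤ W z)
    (hD : ∀ x y : Fin n → ℝ, 0 ≤ S.D x y) (hsupp : ∀ z, ¬ StrictAnti z → W z = 0)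
    (hW : ∀ x y : Fin n → ℝ, StrictAnti x → StrictAnti y → (∀ i j, x i ≠ y j) →
      S.D x y = c * W (interleave x y)) :
    Normalizable W ∧ ∀ k₁ k₂ : ℕ, k₁ ≤ n → k₂ ≤ n → ∀ (x : Fin k₁ → ℝ) (y : Fin k₂ → ℝ),
      (∀ i j, x i ≠ y j) → SliceIntegrable (twoSpecies (normalize W)) x y ∧
        correlation (twoSpecies (normalize W)) x y = S.D x y := by
  have hsum := sum_perm_weight S hsupp hW
  have hlint := lintegral_weight hc hm hpos hD hsum
  have hint : Integrable W := by
    refine ⟨hm.aestronglyMeasurable, ?_⟩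
    rw [hasFiniteIntegral_iff_ofReal (.of_forall hpos), hlint]
    exact ENNReal.ofReal_lt_top
  have hI : ∫ z, W z = c⁻¹ := by
    rw [integral_eq_lintegral_of_nonneg_ae (.of_forall hpos) hm.aestronglyMeasurable, hlint,
      ENNReal.toReal_ofReal (by positivity)]
  refine ⟨⟨hpos, hint, by rw [hI]; positivity⟩, ?_⟩
  intro k₁ k₂ h₁ h₂ x y hxy
  have hts : ∀ X Y : Fin n → ℝ, (∀ i j, X i ≠ Y j) →
      twoSpecies (normalize W) X Y = 1 / (n.factorial : ℝ) ^ 2 * S.D X Y := by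
    intro X Y hXY
    rw [twoSpecies, hsum X Y hXY]
    congr 1
    simp only [normalize, hI, div_inv_eq_mul, ← Finset.sum_mul]
    ring
  have hae : (fun st : (Fin (n - k₁) → ℝ) × (Fin (n - k₂) → ℝ) =>
      twoSpecies (normalize W) (extend x st.1) (extend y st.2)) =ᵐ[volume]
      fun st => 1 / (n.factorial : ℝ) ^ 2 * S.D (extend x st.1) (extend y st.2) := by
    filter_upwards [ae_ne_extend h₁ h₂ hxy] with st hst using hts _ _ hst
  have hl := lintegral_D_extend hD h₁ h₂ x y
  have hme := measurable_D_extend (S := S) h₁ h₂ x y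
  have hDi : Integrable fun st : (Fin (n - k₁) → ℝ) × (Fin (n - k₂) → ℝ) =>
      S.D (extend x st.1) (extend y st.2) := by
    refine ⟨hme.aestronglyMeasurable, ?_⟩
    rw [hasFiniteIntegral_iff_ofReal (.of_forall fun _ => hD _ _), hl]
    exact ENNReal.mul_lt_top (ENNReal.mul_lt_top (ENNReal.natCast_lt_top _)
      (ENNReal.natCast_lt_top _)) ENNReal.ofReal_lt_top
  refine ⟨(hDi.const_mul _).congr hae.symm, ?_⟩
  have hDnn : 0 ≤ S.D x y := BiorthogonalSystem.D_nonneg hD (2 * n - (k₁ + k₂)) x y (by simpa)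
    (by simpa) (by simp; omega)
  rw [correlation, integral_congr_ae hae, integral_const_mul,
    integral_eq_lintegral_of_nonneg_ae (.of_forall fun _ => hD _ _) hme.aestronglyMeasurable, hl,
    ENNReal.toReal_mul, ENNReal.toReal_mul, ENNReal.toReal_natCast, ENNReal.toReal_natCast,
    ENNReal.toReal_ofReal hDnn]
  have e1 : ((n - k₁).factorial : ℝ) * n.descFactorial k₁ = n.factorial := by
    exact_mod_cast Nat.factorial_mul_descFactorial h₁
  have e2 : ((n - k₂).factorial : ℝ) * n.descFactorial k₂ = n.factorial := by
    exact_mod_cast Nat.factorial_mul_descFactorial h₂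
  have hn : (n.factorial : ℝ) ≠ 0 := by exact_mod_cast n.factorial_ne_zero
  calc _ = (((n - k₁).factorial : ℝ) * n.descFactorial k₁) *
        (((n - k₂).factorial : ℝ) * n.descFactorial k₂) / (n.factorial : ℝ) ^ 2 * S.D x y := by
          ring
    _ = S.D x y := by rw [e1, e2]; field_simp

end Correlation

/-! ### Systems of polynomials times a weight -/

/-- Data for a biorthogonal system on `I` with `φ i = w r i`, `ψ i = w q i` for polynomials `q i`,
`r i` and the transition function `g(x) / g(y)` for `y < x`. -/
structure WeightedSystem (n : ℕ) where
  I : Set ℝ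
  w : ℝ → ℝ
  g : ℝ → ℝ
  u : ℝ → ℝ
  q : Fin n → Polynomial ℝ
  r : Fin n → Polynomial ℝ
  b : Fin n → ℝ → ℝ
  measurableSet_I : MeasurableSet I
  measurable_w : Measurable w
  measurable_g : Measurable g
  w_pos : ∀ x ∈ I, 0 < w x
  g_pos : ∀ x ∈ I, 0 < g x
  u_pos : ∀ x ∈ I, 0 < u x
  natDegree_q_le : ∀ i, (q i).natDegree ≤ i
  natDegree_r_le : ∀ i, (r i).natDegree ≤ i
  coeff_pos : ∀ i, 0 < (r i).coeff i * (q i).coeff i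
  ratio_le : ∀ x ∈ I, ∀ y ∈ I, y < x → g x / g y ≤ u x / u y
  integrableOn_r : ∀ i, IntegrableOn (fun x => w x * (r i).eval x * u x) I
  integrableOn_q : ∀ i, IntegrableOn (fun y => w y * (q i).eval y * (u y)⁻¹) I
  integral_r : ∀ i, ∀ y ∈ I, ∫ x in I ∩ Set.Ioi y, w x * (r i).eval x * (g x / g y) = b i y
  integral_b : ∀ i j, ∫ y in I, b i y * (w y * (q j).eval y) = if i = j then 1 else 0

namespace WeightedSystem

variable {n : ℕ} (T : WeightedSystem n)

open Classical in
/-- The transition function. -/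
noncomputable def f (x y : ℝ) : ℝ := if (x ∈ T.I ∧ y ∈ T.I) ∧ y < x then T.g x / T.g y else 0

lemma integral_indicator_mul_f (i : Fin n) {y : ℝ} (hy : y ∈ T.I) :
    ∫ x, T.I.indicator (fun x => T.w x * (T.r i).eval x) x * T.f x y = T.b i y := by
  rw [← T.integral_r i y hy, ← integral_indicator (T.measurableSet_I.inter measurableSet_Ioi)]
  congr 1
  ext x
  by_cases hx : x ∈ T.I
  · by_cases hxy : y < x <;> simp [f, hx, hy, hxy, Set.indicator]
  · simp [f, hx]

/-- The biorthogonal system of a weighted system. -/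
noncomputable def toBiorthogonalSystem : BiorthogonalSystem (Fin n) where
  φ i := T.I.indicator fun x => T.w x * (T.r i).eval x
  ψ i := T.I.indicator fun x => T.w x * (T.q i).eval x
  f := T.f
  u := T.I.indicator T.u
  v := T.I.indicator fun y => (T.u y)⁻¹
  measurable_φ i := (T.measurable_w.mul (T.r i).continuous.measurable).indicator T.measurableSet_I
  measurable_ψ i := (T.measurable_w.mul (T.q i).continuous.measurable).indicator T.measurableSet_I
  measurable_f := by
    refine Measurable.ite ?_ ((T.measurable_g.comp measurable_fst).div
      (T.measurable_g.comp measurable_snd)) measurable_const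
    exact (T.measurableSet_I.prod T.measurableSet_I).inter
      (measurableSet_lt measurable_snd measurable_fst)
  abs_f_le x y := by
    unfold f
    split_ifs with h
    · obtain ⟨⟨hx, hy⟩, hxy⟩ := h
      rw [Set.indicator_of_mem hx, Set.indicator_of_mem hy,
        abs_of_pos (div_pos (T.g_pos x hx) (T.g_pos y hy)), ← div_eq_mul_inv]
      exact T.ratio_le x hx y hy hxy
    · rw [abs_zero]
      exact mul_nonneg (Set.indicator_nonneg (fun x hx => (T.u_pos x hx).le) _)
        (Set.indicator_nonneg (fun x hx => (inv_pos.2 (T.u_pos x hx)).le) _)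
  integrable_φ i := by
    refine ((integrable_indicator_iff T.measurableSet_I).2 (T.integrableOn_r i)).congr
      (.of_forall fun x => ?_)
    by_cases hx : x ∈ T.I <;> simp [hx]
  integrable_ψ i := by
    refine ((integrable_indicator_iff T.measurableSet_I).2 (T.integrableOn_q i)).congr
      (.of_forall fun x => ?_)
    by_cases hx : x ∈ T.I <;> simp [hx]
  biorthogonal i j := by
    rw [← T.integral_b i j, ← integral_indicator T.measurableSet_I]
    congr 1
    ext y
    by_cases hy : y ∈ T.I
    · rw [T.integral_indicator_mul_f i hy]
      simp [hy]
    · simp [hy]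

/-- The matrix is a Vandermonde matrix times the triangular matrix of coefficients; only the
coefficients of degree `i` in `p i` reach the determinant. -/
lemma det_eval {p : Fin n → Polynomial ℝ} (hp : ∀ i, (p i).natDegree ≤ i) (x : Fin n → ℝ) :
    (Matrix.of fun j i => (p i).eval (x j)).det =
      (∏ i, ∏ j ∈ Finset.Ioi i, (x j - x i)) * ∏ i, (p i).coeff i := by
  rw [Matrix.eval_matrixOfPolynomials_eq_vandermonde_mul_matrixOfPolynomials x p hp,
    Matrix.det_mul, Matrix.det_vandermonde,
    Matrix.det_of_isUpperTriangular (Matrix.matrixOfPolynomials_blockTriangular p hp)]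
  simp

/-- The product of all differences within the two species. -/
noncomputable def vandermondeProd (x y : Fin n → ℝ) : ℝ :=
  ∏ j, ∏ k ∈ Finset.Ioi j, (x j - x k) * (y j - y k)

lemma vandermondeProd_pos {x y : Fin n → ℝ} (hx : StrictAnti x) (hy : StrictAnti y) :
    0 < vandermondeProd x y := by
  refine Finset.prod_pos fun j _ => Finset.prod_pos fun k hk => ?_
  have hk := Finset.mem_Ioi.1 hk
  exact mul_pos (sub_pos.2 (hx hk)) (sub_pos.2 (hy hk))

/-- The product of the leading coefficients. -/
noncomputable def leadProd : ℝ := ∏ i, (T.r i).coeff i * (T.q i).coeff i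

lemma leadProd_pos : 0 < T.leadProd := Finset.prod_pos fun i _ => T.coeff_pos i

lemma det_indicator (p : Fin n → Polynomial ℝ) {x : Fin n → ℝ} (hx : ∀ j, x j ∈ T.I) :
    (Matrix.of fun j i => T.I.indicator (fun x => T.w x * (p i).eval x) (x j)).det =
      (∏ j, T.w (x j)) * (Matrix.of fun j i => (p i).eval (x j)).det := by
  rw [← Matrix.det_mul_column]
  congr 1
  ext j i
  simp [hx j]

lemma det_f {x y : Fin n → ℝ} (hx : ∀ j, x j ∈ T.I) (hy : ∀ j, y j ∈ T.I) :
    (Matrix.of fun j l => T.f (x j) (y l)).det =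
      (∏ j, T.g (x j) / T.g (y j)) *
        (Matrix.of fun j l => if y l < x j then (1 : ℝ) else 0).det := by
  rw [Finset.prod_div_distrib, div_eq_mul_inv, ← Finset.prod_inv_distrib, mul_assoc,
    ← Matrix.det_mul_row, ← Matrix.det_mul_column]
  congr 1
  ext j l
  simp only [f, hx, hy, Matrix.of_apply]
  split_ifs with h h2
  · simp [div_eq_mul_inv]
  · exact absurd h.2 h2
  · rename_i h3
    simp_all
  · simp

open Classical in
-- In the triple product, the determinants of φ and ψ give the weights, the two Vandermonde products
-- and the leading coefficients, while the determinant of `f` gives the ratios of `g` and the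
-- interlacing indicator.
lemma D_of_strictAnti {x y : Fin n → ℝ} (hx : StrictAnti x) (hy : StrictAnti y)
    (hxI : ∀ j, x j ∈ T.I) (hyI : ∀ j, y j ∈ T.I) :
    T.toBiorthogonalSystem.D x y = T.leadProd * ((∏ j, T.w (x j)) * (∏ j, T.w (y j)) *
      (∏ j, T.g (x j) / T.g (y j)) * vandermondeProd x y *
        if ∀ j l, y l < x j ↔ j ≤ l then 1 else 0) := by
  rw [← det_lt_indicator hx hy, BiorthogonalSystem.D_eq_mul]
  simp only [toBiorthogonalSystem]
  rw [T.det_indicator _ hxI, T.det_indicator _ hyI, T.det_f hxI hyI, det_eval T.natDegree_r_le,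
    det_eval T.natDegree_q_le, leadProd, Finset.prod_mul_distrib]
  have : vandermondeProd x y = (∏ i, ∏ j ∈ Finset.Ioi i, (x j - x i)) *
      ∏ i, ∏ j ∈ Finset.Ioi i, (y j - y i) := by
    rw [vandermondeProd, ← Finset.prod_mul_distrib]
    refine Finset.prod_congr rfl fun i _ => ?_
    rw [← Finset.prod_mul_distrib]
    exact Finset.prod_congr rfl fun j _ => by ring
  rw [this]
  ring

lemma D_eq_zero_of_notMem {x y : Fin n → ℝ} (h : ¬ ((∀ j, x j ∈ T.I) ∧ ∀ j, y j ∈ T.I)) :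
    T.toBiorthogonalSystem.D x y = 0 := by
  rw [BiorthogonalSystem.D_eq_mul]
  simp only [toBiorthogonalSystem]
  rw [not_and_or, not_forall, not_forall] at h
  rcases h with ⟨j, hj⟩ | ⟨j, hj⟩
  · rw [Matrix.det_eq_zero_of_row_eq_zero j fun l => by simp [hj], zero_mul, zero_mul]
  · rw [Matrix.det_eq_zero_of_row_eq_zero
      (A := Matrix.of fun j i => T.I.indicator (fun x => T.w x * (T.q i).eval x) (y j)) j
      fun l => by simp [hj], mul_zero]

/-- By symmetry one may sort both species and use `D_of_strictAnti`. Repeated points give equal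
rows, and points outside `I` give a zero row. -/
lemma D_nonneg (x y : Fin n → ℝ) : 0 ≤ T.toBiorthogonalSystem.D x y := by
  classical
  by_cases hI : (∀ j, x j ∈ T.I) ∧ ∀ j, y j ∈ T.I
  · by_cases hx : Function.Injective x
    · by_cases hy : Function.Injective y
      · obtain ⟨σ, hσ⟩ := exists_perm_strictAnti hx
        obtain ⟨τ, hτ⟩ := exists_perm_strictAnti hy
        rw [← BiorthogonalSystem.D_comp_equiv _ x y σ τ,
          T.D_of_strictAnti hσ hτ (fun j => hI.1 _) fun j => hI.2 _]
        refine mul_nonneg T.leadProd_pos.le (mul_nonneg (mul_nonneg (mul_nonneg (mul_nonneg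
          ?_ ?_) ?_) (vandermondeProd_pos hσ hτ).le) (by split_ifs <;> simp))
        · exact Finset.prod_nonneg fun j _ => (T.w_pos _ (hI.1 _)).le
        · exact Finset.prod_nonneg fun j _ => (T.w_pos _ (hI.2 _)).le
        · exact Finset.prod_nonneg fun j _ =>
            (div_pos (T.g_pos _ (hI.1 _)) (T.g_pos _ (hI.2 _))).le
      · simp only [Function.Injective, not_forall] at hy
        obtain ⟨i, j, hij, hne⟩ := hy
        rw [BiorthogonalSystem.D_eq_mul, Matrix.det_zero_of_row_eq
          (M := Matrix.of fun j i => T.toBiorthogonalSystem.ψ i (y j)) hne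
          (by ext l; simp [hij]), mul_zero]
    · simp only [Function.Injective, not_forall] at hx
      obtain ⟨i, j, hij, hne⟩ := hx
      rw [BiorthogonalSystem.D_eq_mul, Matrix.det_zero_of_row_eq
        (M := Matrix.of fun j i => T.toBiorthogonalSystem.φ i (x j)) hne
        (by ext l; simp [hij]), zero_mul, zero_mul]
  · rw [T.D_eq_zero_of_notMem hI]

/-- The correlations of the ensemble of a weighted system. -/
theorem correlation_eq {W : (Fin (2 * n) → ℝ) → ℝ}
    (hW1 : ∀ z, StrictAnti z → (∀ i, z i ∈ T.I) → W z = (∏ i, T.w (z i)) *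
      (∏ j : Fin n, T.g (z (oddPos j)) / T.g (z (evenPos j))) * parityVandermonde z)
    (hW0 : ∀ z, ¬ (StrictAnti z ∧ ∀ i, z i ∈ T.I) → W z = 0) :
    Normalizable W ∧ ∀ k₁ k₂ : ℕ, k₁ ≤ n → k₂ ≤ n → ∀ (x : Fin k₁ → ℝ) (y : Fin k₂ → ℝ),
      (∀ i j, x i ≠ y j) → SliceIntegrable (twoSpecies (normalize W)) x y ∧
        correlation (twoSpecies (normalize W)) x y = T.toBiorthogonalSystem.D x y := by
  classical
  have hpv : ∀ z : Fin (2 * n) → ℝ, parityVandermonde z =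
      vandermondeProd (fun j => z (oddPos j)) fun j => z (evenPos j) := fun z => rfl
  have hWeq : W = fun z => if StrictAnti z ∧ ∀ i, z i ∈ T.I then (∏ i, T.w (z i)) *
      (∏ j : Fin n, T.g (z (oddPos j)) / T.g (z (evenPos j))) * parityVandermonde z else 0 := by
    ext z
    split_ifs with h
    · exact hW1 z h.1 h.2
    · exact hW0 z h
  have hpos : ∀ z, 0 ≤ W z := by
    intro z
    by_cases h : StrictAnti z ∧ ∀ i, z i ∈ T.I
    · rw [hW1 z h.1 h.2, hpv]
      have hz : StrictAnti (interleave (fun j => z (oddPos j)) fun j => z (evenPos j)) := by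
        have : interleave (fun j => z (oddPos j)) (fun j => z (evenPos j)) = z := by
          ext i
          revert i
          simp [forall_fin_two_mul]
        rw [this]
        exact h.1
      have h2 := strictAnti_of_strictAnti_interleave hz
      refine mul_nonneg (mul_nonneg ?_ ?_) (vandermondeProd_pos h2.1 h2.2).le
      · exact Finset.prod_nonneg fun j _ => (T.w_pos _ (h.2 _)).le
      · exact Finset.prod_nonneg fun j _ => (div_pos (T.g_pos _ (h.2 _)) (T.g_pos _ (h.2 _))).le
    · rw [hW0 z h]
  have hm : Measurable W := by
    rw [hWeq]
    refine Measurable.ite (MeasurableSet.inter ?_ ?_) ?_ measurable_const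
    · have : {z : Fin (2 * n) → ℝ | StrictAnti z} = ⋂ i, ⋂ j, ⋂ _ : i < j, {z | z j < z i} := by
        ext z
        simp [StrictAnti]
      change MeasurableSet {z : Fin (2 * n) → ℝ | StrictAnti z}
      rw [this]
      exact MeasurableSet.iInter fun i => MeasurableSet.iInter fun j => MeasurableSet.iInter
        fun _ => measurableSet_lt (measurable_pi_apply j) (measurable_pi_apply i)
    · have : {z : Fin (2 * n) → ℝ | ∀ i, z i ∈ T.I} = ⋂ i, {z | z i ∈ T.I} := by
        ext z; simp
      change MeasurableSet {z : Fin (2 * n) → ℝ | ∀ i, z i ∈ T.I}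
      rw [this]
      exact MeasurableSet.iInter fun i => measurable_pi_apply i T.measurableSet_I
    · refine Measurable.mul (Measurable.mul ?_ ?_) ?_
      · exact Finset.measurable_fun_prod _ fun i _ => T.measurable_w.comp (measurable_pi_apply i)
      · exact Finset.measurable_fun_prod _ fun i _ =>
          (T.measurable_g.comp (measurable_pi_apply _)).div
            (T.measurable_g.comp (measurable_pi_apply _))
      · unfold parityVandermonde
        fun_prop
  refine correlation_eq_D T.leadProd_pos hm hpos T.D_nonneg
    (fun z hz => hW0 z fun h => hz h.1) fun x y hx hy hxy => ?_
  by_cases hI : (∀ j, x j ∈ T.I) ∧ ∀ j, y j ∈ T.I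
  · rw [T.D_of_strictAnti hx hy hI.1 hI.2]
    congr 1
    by_cases hz : StrictAnti (interleave x y)
    · rw [hW1 _ hz (forall_fin_two_mul.2 (by simpa using hI)), hpv,
        if_pos ((strictAnti_interleave_iff hx hy hxy).1 hz), prod_fin_two_mul]
      simp
    · rw [hW0 _ fun h => hz h.1, if_neg fun h => hz ((strictAnti_interleave_iff hx hy hxy).2 h),
        mul_zero]
  · rw [T.D_eq_zero_of_notMem hI, hW0 _ fun h => hI (by simpa using forall_fin_two_mul.1 h.2),
      mul_zero]

/-- Reduces the identification of the kernels to four pointwise formulas on `I`: `b i` is β, and the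
integral over `I ∩ Iio x` is α. Only the even-odd block carries the transition function as an extra
term. -/
lemma D_eq_blockDet {k₁ k₂ : ℕ} {Koo Koe Keo Kee : ℝ → ℝ → ℝ} {x : Fin k₁ → ℝ} {y : Fin k₂ → ℝ}
    (hx : ∀ j, x j ∈ T.I) (hy : ∀ j, y j ∈ T.I)
    (hoo : ∀ x ∈ T.I, ∀ x' ∈ T.I, Koo x x' = ∑ i, T.w x * (T.r i).eval x *
      ∫ y in T.I ∩ Set.Iio x', T.g x' / T.g y * (T.w y * (T.q i).eval y))
    (hoe : ∀ x ∈ T.I, ∀ y ∈ T.I, Koe x y = ∑ i, T.w x * (T.r i).eval x *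
      (T.w y * (T.q i).eval y))
    (heo : ∀ y ∈ T.I, ∀ x ∈ T.I, Keo y x = -(if y < x then T.g x / T.g y else 0) +
      ∑ i, T.b i y * ∫ y in T.I ∩ Set.Iio x, T.g x / T.g y * (T.w y * (T.q i).eval y))
    (hee : ∀ y ∈ T.I, ∀ y' ∈ T.I, Kee y y' = ∑ i, T.b i y * (T.w y' * (T.q i).eval y')) :
    T.toBiorthogonalSystem.D x y = blockDet Koo Koe Keo Kee x y := by
  have hα : ∀ i, ∀ x ∈ T.I, T.toBiorthogonalSystem.α i x =
      ∫ y in T.I ∩ Set.Iio x, T.g x / T.g y * (T.w y * (T.q i).eval y) := by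
    intro i x hx
    rw [BiorthogonalSystem.α, ← integral_indicator (T.measurableSet_I.inter measurableSet_Iio)]
    congr 1
    ext y
    by_cases hy : y ∈ T.I
    · by_cases hxy : y < x <;> simp [toBiorthogonalSystem, f, hx, hy, hxy, Set.indicator]
    · simp [toBiorthogonalSystem, f, hy]
  have hβ : ∀ i, ∀ y ∈ T.I, T.toBiorthogonalSystem.β i y = T.b i y := fun i y hy =>
    T.integral_indicator_mul_f i hy
  have hφ : ∀ i, ∀ x ∈ T.I, T.toBiorthogonalSystem.φ i x = T.w x * (T.r i).eval x :=
    fun i x hx => by simp [toBiorthogonalSystem, hx]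
  have hψ : ∀ i, ∀ x ∈ T.I, T.toBiorthogonalSystem.ψ i x = T.w x * (T.q i).eval x :=
    fun i x hx => by simp [toBiorthogonalSystem, hx]
  have hf : ∀ x ∈ T.I, ∀ y ∈ T.I, T.toBiorthogonalSystem.f x y =
      if y < x then T.g x / T.g y else 0 := fun x hx y hy => by simp [toBiorthogonalSystem, f, hx, hy]
  rw [BiorthogonalSystem.D, BiorthogonalSystem.corr_eq_det, blockDet]
  congr 1
  ext (j | j) (l | l)
  · simp only [Matrix.of_apply, Sum.elim_inl, Matrix.fromBlocks_apply₁₁, hoo _ (hx j) _ (hx l),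
      BiorthogonalSystem.K, BiorthogonalSystem.U, BiorthogonalSystem.V, BiorthogonalSystem.N,
      hφ _ _ (hx j), hα _ _ (hx l), sub_zero]
  · simp only [Matrix.of_apply, Sum.elim_inl, Sum.elim_inr, Matrix.fromBlocks_apply₁₂,
      hoe _ (hx j) _ (hy l), BiorthogonalSystem.K, BiorthogonalSystem.U, BiorthogonalSystem.V,
      BiorthogonalSystem.N, hφ _ _ (hx j), hψ _ _ (hy l), sub_zero]
  · simp only [Matrix.of_apply, Sum.elim_inl, Sum.elim_inr, Matrix.fromBlocks_apply₂₁,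
      heo _ (hy j) _ (hx l), BiorthogonalSystem.K, BiorthogonalSystem.U, BiorthogonalSystem.V,
      BiorthogonalSystem.N, hβ _ _ (hy j), hα _ _ (hx l), hf _ (hx l) _ (hy j)]
    rw [sub_eq_neg_add]
  · simp only [Matrix.of_apply, Sum.elim_inr, Matrix.fromBlocks_apply₂₂,
      hee _ (hy j) _ (hy l), BiorthogonalSystem.K, BiorthogonalSystem.U, BiorthogonalSystem.V,
      BiorthogonalSystem.N, hβ _ _ (hy j), hψ _ _ (hy l), sub_zero]

end WeightedSystem

lemma blockDet_elim0 {Koo Koe Keo Kee : ℝ → ℝ → ℝ} {k : ℕ} (y : Fin k → ℝ) :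
    blockDet Koo Koe Keo Kee (Fin.elim0 : Fin 0 → ℝ) y =
      (Matrix.of fun j l : Fin k => Kee (y j) (y l)).det := by
  rw [blockDet, show (Matrix.of fun (j : Fin 0) (l : Fin k) => Koe (Fin.elim0 j) (y l)) = 0 from
    Subsingleton.elim _ _, Matrix.det_fromBlocks_zero₁₂, Matrix.det_isEmpty, one_mul]

/-! ### Alternating binomial sums -/

/-- Such a sum is an `l`-th forward difference at `0`, up to sign. It therefore annihilates
polynomials of degree below `l`, which is the source of both orthogonality relations. -/
lemma sum_neg_one_pow_choose_eq (f : ℝ → ℝ) (l : ℕ) :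
    ∑ k ∈ Finset.range (l + 1), (-1 : ℝ) ^ k * l.choose k * f k =
      (-1) ^ l * (fwdDiff 1)^[l] f 0 := by
  rw [fwdDiff_iter_eq_sum_shift, Finset.mul_sum]
  refine Finset.sum_congr rfl fun k hk => ?_
  have hk : k ≤ l := Nat.lt_succ_iff.1 (Finset.mem_range.1 hk)
  have : (-1 : ℝ) ^ k = (-1) ^ l * (-1) ^ (l - k) := by
    rw [← pow_add, show l + (l - k) = k + 2 * (l - k) by omega, pow_add, pow_mul]
    simp
  simp only [zsmul_eq_mul, nsmul_eq_mul, mul_one, zero_add]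
  rw [this]
  push_cast
  ring

lemma sum_neg_one_pow_choose_eval_eq_zero (P : Polynomial ℝ) {l : ℕ} (hP : P.natDegree < l) :
    ∑ k ∈ Finset.range (l + 1), (-1 : ℝ) ^ k * l.choose k * P.eval (k : ℝ) = 0 := by
  rw [sum_neg_one_pow_choose_eq (fun x => P.eval x), Polynomial.fwdDiff_iter_eq_zero_of_degree_lt hP]
  simp

lemma sum_neg_one_pow_choose_eval_eq_factorial {P : Polynomial ℝ} (hP : P.Monic) :
    ∑ k ∈ Finset.range (P.natDegree + 1), (-1 : ℝ) ^ k * P.natDegree.choose k * P.eval (k : ℝ) =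
      (-1) ^ P.natDegree * P.natDegree.factorial := by
  rw [sum_neg_one_pow_choose_eq (fun x => P.eval x), Polynomial.fwdDiff_iter_degree_eq_factorial]
  simp [hP.leadingCoeff]

lemma fwdDiff_iter_inv (l : ℕ) : ∀ c : ℝ, 0 < c → (fwdDiff 1)^[l] (fun x : ℝ => (x + c)⁻¹) 0 =
    (-1) ^ l * l.factorial / ∏ i ∈ Finset.range (l + 1), (c + i) := by
  have h : ∀ x : ℝ, 0 < x → (fwdDiff 1)^[l] (fun x : ℝ => x⁻¹) x =
      (-1) ^ l * l.factorial / ∏ i ∈ Finset.range (l + 1), (x + i) := by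
    induction l with
    | zero => intro x _; simp
    | succ l ih =>
      intro x hx
      rw [Function.iterate_succ_apply', fwdDiff, ih _ (by positivity), ih _ hx]
      have hp : (∏ i ∈ Finset.range l, (x + 1 + (i : ℝ))) ≠ 0 :=
        (Finset.prod_pos fun i _ => by positivity).ne'
      have e1 : ∏ i ∈ Finset.range (l + 1), (x + 1 + (i : ℝ)) =
          (∏ i ∈ Finset.range l, (x + 1 + (i : ℝ))) * (x + 1 + l) := Finset.prod_range_succ _ _
      have e2 : ∏ i ∈ Finset.range (l + 1), (x + (i : ℝ)) =
          (∏ i ∈ Finset.range l, (x + 1 + (i : ℝ))) * x := by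
        rw [Finset.prod_range_succ']
        congr 1
        · exact Finset.prod_congr rfl fun i _ => by push_cast; ring
        · simp
      have e3 : ∏ i ∈ Finset.range (l + 1 + 1), (x + (i : ℝ)) =
          (∏ i ∈ Finset.range l, (x + 1 + (i : ℝ))) * (x + 1 + l) * x := by
        rw [Finset.prod_range_succ', ← e1]
        congr 1
        · exact Finset.prod_congr rfl fun i _ => by push_cast; ring
        · simp
      rw [e1, e2, e3, Nat.factorial_succ]
      have : x + 1 + (l : ℝ) ≠ 0 := by positivity
      have hx' := hx.ne'
      push_cast
      field_simp
      ring
  intro c hc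
  have := fwdDiff_iter_comp_add (1 : ℝ) (fun x : ℝ => x⁻¹) c l 0
  rw [this, zero_add, h c hc]

lemma sum_neg_one_pow_choose_div {l : ℕ} {c : ℝ} (hc : 0 < c) :
    ∑ k ∈ Finset.range (l + 1), (-1 : ℝ) ^ k * l.choose k * ((k : ℝ) + c)⁻¹ =
      l.factorial / ∏ i ∈ Finset.range (l + 1), (c + i) := by
  rw [sum_neg_one_pow_choose_eq (fun x => (x + c)⁻¹), fwdDiff_iter_inv l c hc]
  have : ((-1 : ℝ) ^ l) * (-1) ^ l = 1 := by rw [← mul_pow]; simp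
  rw [mul_div_assoc, ← mul_assoc, this, one_mul]

/-! ### Orthogonality from moments -/

/-- By symmetry let `i ≤ j` and expand only the polynomial of degree `i` in powers of `e`. By `hlt`,
all powers below `j` are orthogonal to the other factor, so at most the top coefficient survives,
when `i = j`. -/
lemma orthogonal_of_moments {I : Set ℝ} {ρ e : ℝ → ℝ} {c : ℕ → ℕ → ℝ} {mom h : ℕ → ℝ}
    (hint : ∀ m, IntegrableOn (fun x => ρ x * e x ^ m) I)
    (hmom : ∀ m, ∫ x in I, ρ x * e x ^ m = mom m)
    (hlt : ∀ m l, m < l → ∑ k ∈ Finset.range (l + 1), c l k * mom (m + k) = 0)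
    (heq : ∀ l, c l l * ∑ k ∈ Finset.range (l + 1), c l k * mom (l + k) = h l) (i j : ℕ) :
    ∫ x in I, ρ x * ((∑ k ∈ Finset.range (i + 1), c i k * e x ^ k) *
      ∑ k ∈ Finset.range (j + 1), c j k * e x ^ k) = if i = j then h i else 0 := by
  have key : ∀ i j, i ≤ j → ∫ x in I, ρ x * ((∑ k ∈ Finset.range (i + 1), c i k * e x ^ k) *
      ∑ k ∈ Finset.range (j + 1), c j k * e x ^ k) = if i = j then h i else 0 := by
    intro i j hij
    have e1 : ∀ x, ρ x * ((∑ k ∈ Finset.range (i + 1), c i k * e x ^ k) *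
        ∑ k ∈ Finset.range (j + 1), c j k * e x ^ k) = ∑ m ∈ Finset.range (i + 1),
          ∑ k ∈ Finset.range (j + 1), c i m * c j k * (ρ x * e x ^ (m + k)) := by
      intro x
      rw [Finset.sum_mul_sum, Finset.mul_sum]
      refine Finset.sum_congr rfl fun m _ => ?_
      rw [Finset.mul_sum]
      exact Finset.sum_congr rfl fun k _ => by ring
    simp only [e1]
    rw [integral_finsetSum _ fun m _ => integrable_finsetSum _ fun k _ =>
      (hint (m + k)).const_mul _]
    have e2 : ∀ m ∈ Finset.range (i + 1), ∫ x in I, ∑ k ∈ Finset.range (j + 1),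
        c i m * c j k * (ρ x * e x ^ (m + k)) =
        c i m * ∑ k ∈ Finset.range (j + 1), c j k * mom (m + k) := by
      intro m _
      rw [integral_finsetSum _ fun k _ => (hint (m + k)).const_mul _, Finset.mul_sum]
      simp only [integral_const_mul, hmom, mul_assoc]
    rw [Finset.sum_congr rfl e2]
    split_ifs with hij'
    · subst hij'
      rw [Finset.sum_range_succ, heq, Finset.sum_eq_zero, zero_add]
      exact fun m hm => by rw [hlt m i (Finset.mem_range.1 hm), mul_zero]
    · refine Finset.sum_eq_zero fun m hm => ?_
      have := Finset.mem_range.1 hm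
      rw [hlt m j (by omega), mul_zero]
  rcases le_total i j with hij | hij
  · exact key i j hij
  · have h1 := key j i hij
    simp only [eq_comm (a := j)] at h1
    rw [show (if i = j then h i else 0) = if i = j then h j else 0 by
      split_ifs with h2 <;> simp [h2], ← h1]
    congr 1
    ext x
    ring

/-! ### Laguerre polynomials -/

/-- The Laguerre polynomial as a polynomial. -/
noncomputable def laguerrePoly (l : ℕ) : Polynomial ℝ :=
  ∑ k ∈ Finset.range (l + 1), Polynomial.monomial k ((-1) ^ k * l.choose k / k.factorial : ℝ)

lemma laguerreL_eq_sum (l : ℕ) (x : ℝ) : laguerreL l x =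
    ∑ k ∈ Finset.range (l + 1), ((-1) ^ k * l.choose k / k.factorial : ℝ) * x ^ k := by
  refine Finset.sum_congr rfl fun k _ => ?_
  rw [neg_pow]
  ring

lemma eval_laguerrePoly (l : ℕ) (x : ℝ) : (laguerrePoly l).eval x = laguerreL l x := by
  rw [laguerreL_eq_sum, laguerrePoly, Polynomial.eval_finsetSum]
  simp

lemma natDegree_laguerrePoly_le (l : ℕ) : (laguerrePoly l).natDegree ≤ l :=
  Polynomial.natDegree_sum_le_of_forall_le _ _ fun _ hk =>
    (Polynomial.natDegree_monomial_le _).trans (Nat.lt_succ_iff.1 (Finset.mem_range.1 hk))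

lemma coeff_laguerrePoly (l : ℕ) : (laguerrePoly l).coeff l = (-1) ^ l / l.factorial := by
  rw [laguerrePoly, Polynomial.finsetSum_coeff, Finset.sum_range_succ, Finset.sum_eq_zero]
  · simp
  · intro k hk
    exact Polynomial.coeff_monomial_of_ne _ (Finset.mem_range.1 hk).ne'

lemma integrableOn_exp_mul_pow (m : ℕ) :
    IntegrableOn (fun x : ℝ => Real.exp (-x) * x ^ m) (Set.Ici 0) := by
  rw [integrableOn_Ici_iff_integrableOn_Ioi]
  have := Real.GammaIntegral_convergent (s := m + 1) (by positivity)
  simpa using this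

lemma integral_exp_mul_pow (m : ℕ) :
    ∫ x in Set.Ici (0 : ℝ), Real.exp (-x) * x ^ m = m.factorial := by
  rw [integral_Ici_eq_integral_Ioi, ← Real.Gamma_nat_eq_factorial,
    Real.Gamma_eq_integral (by positivity)]
  simp

/-- The quotient `(m + k)! / k!` is the rising factorial `(k + 1)_m`, a monic polynomial of degree
`m` in `k`, so finite differences of order `l` evaluate the sum for `m ≤ l`. -/
lemma laguerre_moment_eq (m l : ℕ) :
    ∑ k ∈ Finset.range (l + 1), ((-1) ^ k * l.choose k / k.factorial : ℝ) *
      ((m + k).factorial : ℝ) = ∑ k ∈ Finset.range (l + 1), (-1 : ℝ) ^ k * l.choose k *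
        ((ascPochhammer ℝ m).comp (Polynomial.X + 1)).eval (k : ℝ) := by
  refine Finset.sum_congr rfl fun k _ => ?_
  have h1 : (((m + k).factorial : ℕ) : ℝ) = k.factorial * ((k + 1).ascFactorial m : ℕ) := by
    rw [← Nat.cast_mul, Nat.factorial_mul_ascFactorial, add_comm]
  have h2 : ((ascPochhammer ℝ m).comp (Polynomial.X + 1)).eval (k : ℝ) =
      ((k + 1).ascFactorial m : ℕ) := by
    rw [← ascPochhammer_nat_eq_ascFactorial (k + 1) m, ascPochhammer_eval_cast]
    simp
  rw [h1, h2]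
  have : (k.factorial : ℝ) ≠ 0 := by exact_mod_cast k.factorial_ne_zero
  field_simp

lemma natDegree_ascPochhammer_comp (m : ℕ) :
    ((ascPochhammer ℝ m).comp (Polynomial.X + 1)).natDegree = m := by
  rw [Polynomial.natDegree_comp, ascPochhammer_natDegree, ← Polynomial.C_1,
    Polynomial.natDegree_X_add_C, mul_one]

lemma integral_laguerreL_mul (i j : ℕ) :
    ∫ x in Set.Ici (0 : ℝ), Real.exp (-x) * (laguerreL i x * laguerreL j x) =
      if i = j then 1 else 0 := by
  simp only [laguerreL_eq_sum]
  refine orthogonal_of_moments (mom := fun m => (m.factorial : ℝ))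
    (c := fun l k => ((-1) ^ k * l.choose k / k.factorial : ℝ)) (h := fun _ => 1)
    integrableOn_exp_mul_pow integral_exp_mul_pow (fun m l hml => ?_) (fun l => ?_) i j
  · rw [laguerre_moment_eq, sum_neg_one_pow_choose_eval_eq_zero]
    rwa [natDegree_ascPochhammer_comp]
  · rw [laguerre_moment_eq]
    have h := sum_neg_one_pow_choose_eval_eq_factorial
      (P := (ascPochhammer ℝ l).comp (Polynomial.X + 1)) ((monic_ascPochhammer ℝ l).comp
        (by rw [← Polynomial.C_1]; exact Polynomial.monic_X_add_C _)
        (by rw [← Polynomial.C_1, Polynomial.natDegree_X_add_C]; exact one_ne_zero))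
    rw [natDegree_ascPochhammer_comp] at h
    rw [h]
    have : (l.factorial : ℝ) ≠ 0 := by exact_mod_cast l.factorial_ne_zero
    have h2 : ((-1 : ℝ) ^ l) * (-1) ^ l = 1 := by rw [← mul_pow]; simp
    simp only [Nat.choose_self, Nat.cast_one, mul_one]
    field_simp
    linear_combination h2

/-! ### Jacobi polynomials -/

lemma ascPochhammer_eval_eq_prod (l : ℕ) (x : ℝ) :
    (ascPochhammer ℝ l).eval x = ∏ i ∈ Finset.range l, (x + i) := by
  induction l with
  | zero => simp
  | succ l ih => rw [ascPochhammer_succ_eval, ih, Finset.prod_range_succ]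

/-- The coefficients of `P_l^{(a,0)}` in powers of `(1 - x) / 2`. -/
noncomputable def jacobiCoeff (a : ℝ) (l k : ℕ) : ℝ :=
  (-1) ^ k * l.choose k * (∏ i ∈ Finset.range l, ((k : ℝ) + (a + 1 + i))) / l.factorial

/-- The rising factorials `(a + k + 1)_{l-k}` and `(l + a + 1)_k` join to `(a + k + 1)_l`. The
coefficients thereby become signed binomials times a polynomial of degree `l` in `k`, ready for
finite differences. -/
lemma jacobiP_eq_sum (a : ℝ) (l : ℕ) (x : ℝ) : jacobiP a 0 l x =
    ∑ k ∈ Finset.range (l + 1), jacobiCoeff a l k * ((1 - x) / 2) ^ k := by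
  refine Finset.sum_congr rfl fun k hk => ?_
  have hk : k ≤ l := Nat.lt_succ_iff.1 (Finset.mem_range.1 hk)
  have h1 : (ascPochhammer ℝ (l - k)).eval (a + k + 1) * (ascPochhammer ℝ k).eval (l + a + 0 + 1) =
      ∏ i ∈ Finset.range l, ((k : ℝ) + (a + 1 + i)) := by
    have h := congrArg (Polynomial.eval (a + k + 1)) (ascPochhammer_mul ℝ (l - k) k)
    rw [Nat.sub_add_cancel hk, Polynomial.eval_mul, Polynomial.eval_comp, Polynomial.eval_add,
      Polynomial.eval_X, Polynomial.eval_natCast, ascPochhammer_eval_eq_prod l,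
      Nat.cast_sub hk, show a + k + 1 + ((l : ℝ) - k) = l + a + 0 + 1 by ring] at h
    rw [h]
    exact Finset.prod_congr rfl fun i _ => by ring
  have h2 : (l.choose k : ℝ) / l.factorial = 1 / ((l - k).factorial * k.factorial) := by
    rw [Nat.cast_choose ℝ hk]
    have : (l.factorial : ℝ) ≠ 0 := by exact_mod_cast l.factorial_ne_zero
    field_simp
  have h3 : ((x - 1) / 2) ^ k = (-1) ^ k * ((1 - x) / 2) ^ k := by
    rw [← mul_pow]
    congr 1
    ring
  have h4 : jacobiCoeff a l k = (-1) ^ k * (∏ i ∈ Finset.range l, ((k : ℝ) + (a + 1 + i))) *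
      ((l.choose k : ℝ) / l.factorial) := by
    rw [jacobiCoeff]; ring
  rw [h4, h2, ← h1, h3]
  field_simp

/-- The Jacobi polynomial `P_l^{(a,0)}` as a polynomial. -/
noncomputable def jacobiPoly (a : ℝ) (l : ℕ) : Polynomial ℝ :=
  ∑ k ∈ Finset.range (l + 1), Polynomial.C (jacobiCoeff a l k) *
    (Polynomial.C (-1 / 2) * Polynomial.X + Polynomial.C (1 / 2)) ^ k

lemma eval_jacobiPoly (a : ℝ) (l : ℕ) (x : ℝ) : (jacobiPoly a l).eval x = jacobiP a 0 l x := by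
  rw [jacobiP_eq_sum, jacobiPoly, Polynomial.eval_finsetSum]
  refine Finset.sum_congr rfl fun k _ => ?_
  simp only [Polynomial.eval_mul, Polynomial.eval_pow, Polynomial.eval_add, Polynomial.eval_C,
    Polynomial.eval_X]
  congr 2
  ring

lemma natDegree_linear_pow_le (k : ℕ) :
    ((Polynomial.C (-1 / 2 : ℝ) * Polynomial.X + Polynomial.C (1 / 2)) ^ k).natDegree ≤ k :=
  (Polynomial.natDegree_pow_le_of_le k Polynomial.natDegree_linear_le).trans (by simp)

lemma natDegree_jacobiPoly_le (a : ℝ) (l : ℕ) : (jacobiPoly a l).natDegree ≤ l :=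
  Polynomial.natDegree_sum_le_of_forall_le _ _ fun k hk =>
    (Polynomial.natDegree_C_mul_le _ _).trans
      ((natDegree_linear_pow_le k).trans (Nat.lt_succ_iff.1 (Finset.mem_range.1 hk)))

lemma coeff_jacobiPoly (a : ℝ) (l : ℕ) :
    (jacobiPoly a l).coeff l = jacobiCoeff a l l * (-1 / 2) ^ l := by
  rw [jacobiPoly, Polynomial.finsetSum_coeff, Finset.sum_range_succ, Finset.sum_eq_zero, zero_add,
    Polynomial.coeff_C_mul]
  · congr 1
    have := Polynomial.coeff_pow_of_natDegree_le (p := Polynomial.C (-1 / 2 : ℝ) * Polynomial.X +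
      Polynomial.C (1 / 2)) (m := l) (n := 1) Polynomial.natDegree_linear_le
    rw [mul_one] at this
    rw [this]
    simp
  · intro k hk
    exact Polynomial.coeff_eq_zero_of_natDegree_lt ((Polynomial.natDegree_C_mul_le _ _).trans_lt
      ((natDegree_linear_pow_le k).trans_lt (Finset.mem_range.1 hk)))

lemma jacobiCoeff_self_ne_zero {a : ℝ} (ha : -1 < a) (l : ℕ) : jacobiCoeff a l l ≠ 0 := by
  have h1 : 0 < ∏ i ∈ Finset.range l, ((l : ℝ) + (a + 1 + i)) := Finset.prod_pos fun i _ => by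
    have : (0 : ℝ) ≤ l := by positivity
    have : (0 : ℝ) ≤ i := by positivity
    linarith
  have h2 : (l.factorial : ℝ) ≠ 0 := by exact_mod_cast l.factorial_ne_zero
  rw [jacobiCoeff]
  simp [h1.ne', h2]

lemma integrableOn_rpow_one_sub {s : ℝ} (hs : -1 < s) (c d : ℝ) :
    IntegrableOn (fun x : ℝ => (1 - x) ^ s) (Set.Ioc c d) := by
  rcases le_total d c with h | h
  · simp [Set.Ioc_eq_empty_of_le h]
  · have h1 := (intervalIntegral.intervalIntegrable_rpow' hs (a := 1 - c) (b := 1 - d))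
    have h2 := h1.comp_sub_left 1
    simp only [sub_sub_cancel] at h2
    exact (intervalIntegrable_iff_integrableOn_Ioc_of_le h).1 h2

lemma integral_rpow_one_sub {s : ℝ} (hs : -1 < s) :
    ∫ x in Set.Ioo (-1 : ℝ) 1, (1 - x) ^ s = 2 ^ (s + 1) / (s + 1) := by
  rw [← integral_Ioc_eq_integral_Ioo, ← intervalIntegral.integral_of_le (by norm_num),
    intervalIntegral.integral_comp_sub_left (fun x => x ^ s) 1, integral_rpow (Or.inl hs)]
  rw [sub_self, Real.zero_rpow (by linarith)]
  norm_num

lemma rpow_mul_half_pow (a : ℝ) {x : ℝ} (hx : x ∈ Set.Ioo (-1 : ℝ) 1) (m : ℕ) :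
    (1 - x) ^ a * ((1 - x) / 2) ^ m = (1 - x) ^ (a + m) * (1 / 2) ^ m := by
  have : 0 < 1 - x := by linarith [hx.2]
  rw [Real.rpow_add_natCast this.ne', div_eq_mul_one_div, mul_pow]
  ring

/-- For `m < l` the denominator `k + a + 1 + m` of the moment is one of the `l` linear factors of
the coefficient. Cancelling it leaves a polynomial of degree `l - 1` in `k`. -/
lemma jacobi_sum_eq_zero (a : ℝ) (ha : -1 < a) {m l : ℕ} (hml : m < l) :
    ∑ k ∈ Finset.range (l + 1), jacobiCoeff a l k * (2 ^ (a + 1) / (a + (m + k : ℕ) + 1)) = 0 := by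
  have h := sum_neg_one_pow_choose_eval_eq_zero
    (∏ i ∈ (Finset.range l).erase m, (Polynomial.X + Polynomial.C (a + 1 + i))) (l := l) (by
      rw [Polynomial.natDegree_prod_of_monic _ _ fun i _ => Polynomial.monic_X_add_C _]
      simp only [Polynomial.natDegree_X_add_C, Finset.sum_const, smul_eq_mul, mul_one]
      rw [Finset.card_erase_of_mem (Finset.mem_range.2 hml), Finset.card_range]
      omega)
  have e : ∀ k ∈ Finset.range (l + 1), jacobiCoeff a l k * (2 ^ (a + 1) / (a + (m + k : ℕ) + 1)) =
      (2 ^ (a + 1) / l.factorial) * ((-1 : ℝ) ^ k * l.choose k *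
        (∏ i ∈ (Finset.range l).erase m, (Polynomial.X + Polynomial.C (a + 1 + i))).eval
          (k : ℝ)) := by
    intro k _
    have hk : (k : ℝ) + (a + 1 + m) ≠ 0 := by
      have : (0 : ℝ) ≤ k := by positivity
      have : (0 : ℝ) ≤ m := by positivity
      linarith
    rw [jacobiCoeff, ← Finset.mul_prod_erase _ _ (Finset.mem_range.2 hml), Polynomial.eval_prod]
    simp only [Polynomial.eval_add, Polynomial.eval_X, Polynomial.eval_C]
    push_cast
    rw [show a + ((m : ℝ) + k) + 1 = k + (a + 1 + m) by ring]
    field_simp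
  rw [Finset.sum_congr rfl e, ← Finset.mul_sum, h, mul_zero]

/-- Now the denominator `k + c`, with `c = a + 1 + l`, is not among the factors of `Q`. Division by
`X + c` leaves a quotient which the alternating sum annihilates and the remainder `Q(-c) = (-1)^l
l!`, which multiplies the known sum of the reciprocals of `k + c`. -/
lemma jacobi_sum_eq (a : ℝ) (ha : -1 < a) (l : ℕ) : jacobiCoeff a l l *
    ∑ k ∈ Finset.range (l + 1), jacobiCoeff a l k * (2 ^ (a + 1) / (a + (l + k : ℕ) + 1)) =
      jacobiNorm a l := by
  set c : ℝ := a + 1 + l with hc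
  have hc0 : 0 < c := by
    have : (0 : ℝ) ≤ l := by positivity
    linarith
  let Q : Polynomial ℝ := ∏ i ∈ Finset.range l, (Polynomial.X + Polynomial.C (a + 1 + i))
  have hQd : Q.natDegree = l := by
    rw [Polynomial.natDegree_prod_of_monic _ _ fun i _ => Polynomial.monic_X_add_C _]
    simp only [Polynomial.natDegree_X_add_C, Finset.sum_const, smul_eq_mul, mul_one,
      Finset.card_range]
  have hQe : ∀ x, Q.eval x = ∏ i ∈ Finset.range l, (x + (a + 1 + i)) := by
    intro x
    simp [Q, Polynomial.eval_prod]
  have hQc : Q.eval (-c) = (-1) ^ l * l.factorial := by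
    rw [hQe, ← Finset.prod_range_add_one_eq_factorial, Nat.cast_prod, ← Finset.prod_range_reflect]
    rw [show (-1 : ℝ) ^ l = ∏ i ∈ Finset.range l, (-1 : ℝ) by simp, ← Finset.prod_mul_distrib]
    refine Finset.prod_congr rfl fun i hi => ?_
    have : i + 1 ≤ l := Finset.mem_range.1 hi
    rw [show l - 1 - i = l - (i + 1) by omega]
    push_cast [this]
    rw [hc]
    ring
  have hR : ∑ k ∈ Finset.range (l + 1), (-1 : ℝ) ^ k * l.choose k *
      (Q /ₘ (Polynomial.X - Polynomial.C (-c))).eval (k : ℝ) = 0 := by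
    rcases Nat.eq_zero_or_pos l with h0 | h0
    · have : Q /ₘ (Polynomial.X - Polynomial.C (-c)) = 0 := by
        rw [Polynomial.divByMonic_eq_zero_iff (Polynomial.monic_X_sub_C _)]
        rw [Polynomial.degree_X_sub_C]
        refine lt_of_le_of_lt Polynomial.degree_le_natDegree ?_
        rw [hQd, h0]
        norm_num
      simp only [this, Polynomial.eval_zero, mul_zero, Finset.sum_const_zero]
    · refine sum_neg_one_pow_choose_eval_eq_zero _ ?_
      rw [Polynomial.natDegree_divByMonic _ (Polynomial.monic_X_sub_C _),
        Polynomial.natDegree_X_sub_C, hQd]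
      omega
  have hdiv : ∀ k : ℕ, Q.eval (k : ℝ) * ((k : ℝ) + c)⁻¹ =
      (Q /ₘ (Polynomial.X - Polynomial.C (-c))).eval (k : ℝ) +
        Q.eval (-c) * ((k : ℝ) + c)⁻¹ := by
    intro k
    have h := congrArg (Polynomial.eval (k : ℝ)) (Polynomial.modByMonic_add_div Q
      (Polynomial.X - Polynomial.C (-c)))
    rw [Polynomial.modByMonic_X_sub_C_eq_C_eval] at h
    simp only [Polynomial.eval_add, Polynomial.eval_mul, Polynomial.eval_sub, Polynomial.eval_X,
      Polynomial.eval_C, sub_neg_eq_add] at h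
    have hk : (k : ℝ) + c ≠ 0 := by positivity
    rw [← h]
    field_simp
    ring
  have e : ∀ k ∈ Finset.range (l + 1), jacobiCoeff a l k * (2 ^ (a + 1) / (a + (l + k : ℕ) + 1)) =
      (2 ^ (a + 1) / l.factorial) * ((-1 : ℝ) ^ k * l.choose k *
        (Q /ₘ (Polynomial.X - Polynomial.C (-c))).eval (k : ℝ)) +
      (2 ^ (a + 1) / l.factorial) * Q.eval (-c) *
        ((-1 : ℝ) ^ k * l.choose k * ((k : ℝ) + c)⁻¹) := by
    intro k _
    rw [jacobiCoeff, ← hQe]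
    push_cast
    rw [show a + ((l : ℝ) + k) + 1 = k + c by rw [hc]; ring]
    linear_combination (2 ^ (a + 1) / l.factorial * ((-1 : ℝ) ^ k * l.choose k)) * hdiv k
  rw [Finset.sum_congr rfl e, Finset.sum_add_distrib, ← Finset.mul_sum, ← Finset.mul_sum, hR,
    sum_neg_one_pow_choose_div hc0, hQc, jacobiCoeff, jacobiNorm, Finset.prod_range_succ]
  have hp : ∏ i ∈ Finset.range l, ((l : ℝ) + (a + 1 + i)) = ∏ i ∈ Finset.range l, (c + (i : ℝ)) :=
    Finset.prod_congr rfl fun i _ => by rw [hc]; ring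
  have hp0 : ∏ i ∈ Finset.range l, (c + (i : ℝ)) ≠ 0 :=
    (Finset.prod_pos fun i _ => by positivity).ne'
  rw [hp, show 2 * (l : ℝ) + a + 1 = c + l by rw [hc]; ring]
  have h1 : (l.factorial : ℝ) ≠ 0 := by exact_mod_cast l.factorial_ne_zero
  have h2 : c + (l : ℝ) ≠ 0 := by positivity
  have h3 : ((-1 : ℝ) ^ l) * (-1) ^ l = 1 := by rw [← mul_pow]; simp
  rw [Nat.choose_self]
  field_simp
  push_cast
  linear_combination (l.factorial : ℝ) ^ 2 * h3

lemma integral_jacobiP_mul {a : ℝ} (ha : -1 < a) (i j : ℕ) :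
    ∫ x in Set.Ioo (-1 : ℝ) 1, (1 - x) ^ a * (jacobiP a 0 i x * jacobiP a 0 j x) =
      if i = j then jacobiNorm a i else 0 := by
  simp only [jacobiP_eq_sum]
  have hm : ∀ m : ℕ, -1 < a + m := fun m => by
    have : (0 : ℝ) ≤ m := by positivity
    linarith
  refine orthogonal_of_moments (mom := fun m => 2 ^ (a + 1) / (a + (m : ℕ) + 1))
    (c := jacobiCoeff a) (h := jacobiNorm a) (fun m => ?_) (fun m => ?_)
    (fun m l hml => jacobi_sum_eq_zero a ha hml) (jacobi_sum_eq a ha) i j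
  · have := ((integrableOn_rpow_one_sub (hm m) (-1) 1).mono_set
      Set.Ioo_subset_Ioc_self).mul_const ((1 / 2 : ℝ) ^ m)
    exact IntegrableOn.congr_fun this (fun x hx => (rpow_mul_half_pow a hx m).symm)
      measurableSet_Ioo
  · rw [setIntegral_congr_fun measurableSet_Ioo fun x hx => rpow_mul_half_pow a hx m,
      integral_mul_const, integral_rpow_one_sub (hm m), add_right_comm,
      Real.rpow_add_natCast (by norm_num)]
    have : a + m + 1 ≠ 0 := by linarith [hm m]
    have h2 : (2 : ℝ) ^ m * (1 / 2) ^ m = 1 := by rw [← mul_pow]; norm_num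
    rw [add_right_comm]
    linear_combination (2 ^ (a + 1) / (a + m + 1)) * h2

lemma jacobiNorm_pos {a : ℝ} (ha : -1 < a) (l : ℕ) : 0 < jacobiNorm a l := by
  have : (0 : ℝ) ≤ l := by positivity
  exact div_pos (by positivity) (by linarith)

/-! ### The Laguerre ensemble -/

lemma hasDerivAt_mul_sum {n : ℕ} {G : ℝ → ℝ} {p : Fin n → ℝ → ℝ} {d : Fin n → ℝ} {x : ℝ}
    (h : ∀ i, HasDerivAt (fun t => G t * p i t) (d i) x) (J : Fin n → ℝ) :
    HasDerivAt (fun t => G t * ∑ i, p i t * J i) (∑ i, d i * J i) x := by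
  have := HasDerivAt.fun_sum (u := Finset.univ) fun i _ => (h i).mul_const (J i)
  refine this.congr_of_eventuallyEq (.of_forall fun t => ?_)
  simp only [Finset.mul_sum]
  exact Finset.sum_congr rfl fun i _ => by ring

lemma integrableOn_exp_mul_eval {c : ℝ} (hc : 0 < c) (p : Polynomial ℝ) :
    IntegrableOn (fun x => Real.exp (-c * x) * p.eval x) (Set.Ici 0) := by
  rw [integrableOn_Ici_iff_integrableOn_Ioi]
  simp only [Polynomial.eval_eq_sum_range, Finset.mul_sum]
  refine integrable_finsetSum _ fun k _ => ?_
  have hk : (-1 : ℝ) < k := by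
    have : (0 : ℝ) ≤ k := by positivity
    linarith
  have := (integrableOn_rpow_mul_exp_neg_mul_rpow hk one_pos hc).const_mul (p.coeff k)
  refine this.congr (.of_forall fun x => ?_)
  simp only [Real.rpow_natCast, Real.rpow_one]
  ring

lemma hasDerivAt_exp_mul_eval (c : ℝ) (p : Polynomial ℝ) (x : ℝ) :
    HasDerivAt (fun x => Real.exp (-c * x) * p.eval x)
      (-(Real.exp (-c * x) * (Polynomial.C c * p - p.derivative).eval x)) x := by
  have h1 : HasDerivAt (fun x => Real.exp (-c * x)) (Real.exp (-c * x) * (-c)) x := by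
    simpa using ((hasDerivAt_id x).const_mul (-c)).exp
  refine (h1.mul (p.hasDerivAt x)).congr_deriv ?_
  simp only [Polynomial.eval_sub, Polynomial.eval_mul, Polynomial.eval_C]
  ring

/-- The integrand is minus a derivative. The boundary value at infinity vanishes since both the
function and its derivative are integrable. -/
lemma integral_Ioi_exp_mul_eval {c : ℝ} (hc : 0 < c) (p : Polynomial ℝ) {y : ℝ} (hy : 0 ≤ y) :
    ∫ x in Set.Ioi y, Real.exp (-c * x) * (Polynomial.C c * p - p.derivative).eval x =
      Real.exp (-c * y) * p.eval y := by
  have hsub : Set.Ioi y ⊆ Set.Ici 0 := fun x hx => hy.trans (le_of_lt hx)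
  have h1 := (integrableOn_exp_mul_eval hc (Polynomial.C c * p - p.derivative)).mono_set hsub
  have h2 := (integrableOn_exp_mul_eval hc p).mono_set hsub
  have h3 := tendsto_zero_of_hasDerivAt_of_integrableOn_Ioi
    (fun x _ => hasDerivAt_exp_mul_eval c p x) h1.neg h2
  have h4 := integral_Ioi_of_hasDerivAt_of_tendsto'
    (fun x _ => hasDerivAt_exp_mul_eval c p x) h1.neg h3
  rw [integral_neg, zero_sub, neg_inj] at h4
  exact h4

lemma natDegree_sub_derivative_le {p : Polynomial ℝ} {i : ℕ} (hp : p.natDegree ≤ i) (c : ℝ) :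
    (Polynomial.C c * p - p.derivative).natDegree ≤ i :=
  (Polynomial.natDegree_sub_le _ _).trans (max_le
    ((Polynomial.natDegree_C_mul_le _ _).trans hp)
    ((Polynomial.natDegree_derivative_le p).trans (by omega)))

/-- The weighted system of the Laguerre ensemble. -/
noncomputable def laguerreSystem (n : ℕ) (A : ℝ) (hA : A < 1) : WeightedSystem n where
  I := Set.Ici 0
  w x := Real.exp (-x / 2)
  g x := Real.exp (A * x / 2)
  -- With `g` itself in place of `u`, integrability of `w * q i / g` could fail for `A ≤ -1`. Since
  -- `f` lives on `y < x`, the exponent may be raised to `max A 0`, which is still below 1.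
  u x := Real.exp (max A 0 * x / 2)
  q i := laguerrePoly i
  -- Chosen so that `w * r i * g` is minus the derivative of `g * w * q i`; the integral over `x >
  -- y` then telescopes to `b i y = w y * q i y`.
  r i := Polynomial.C ((1 - A) / 2) * laguerrePoly i - (laguerrePoly i).derivative
  b i y := Real.exp (-y / 2) * (laguerrePoly i).eval y
  measurableSet_I := measurableSet_Ici
  measurable_w := by fun_prop
  measurable_g := by fun_prop
  w_pos _ _ := Real.exp_pos _
  g_pos _ _ := Real.exp_pos _
  u_pos _ _ := Real.exp_pos _
  natDegree_q_le i := natDegree_laguerrePoly_le i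
  natDegree_r_le i := natDegree_sub_derivative_le (natDegree_laguerrePoly_le i) _
  coeff_pos i := by
    have h : (laguerrePoly i).coeff (i + 1) = 0 := Polynomial.coeff_eq_zero_of_natDegree_lt
      (Nat.lt_succ_iff.2 (natDegree_laguerrePoly_le i))
    have h2 : (laguerrePoly i).coeff i ≠ 0 := by
      rw [coeff_laguerrePoly]
      have : ((i : ℕ).factorial : ℝ) ≠ 0 := by exact_mod_cast (i : ℕ).factorial_ne_zero
      positivity
    -- The derivative has no term of degree `i`, so the coefficient of `r i` is `(1 - A) / 2` times
    -- that of `q i`, and the product is positive.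
    rw [Polynomial.coeff_sub, Polynomial.coeff_C_mul, Polynomial.coeff_derivative, h, zero_mul,
      sub_zero, mul_assoc]
    exact mul_pos (by linarith) (mul_self_pos.2 h2)
  ratio_le x _ y _ hxy := by
    rw [← Real.exp_sub, ← Real.exp_sub, Real.exp_le_exp]
    have := mul_le_mul_of_nonneg_right (le_max_left A 0) (sub_pos.2 hxy).le
    linarith
  integrableOn_r i := by
    have hB : max A 0 < 1 := max_lt hA one_pos
    refine (integrableOn_exp_mul_eval (c := (1 - max A 0) / 2) (by linarith)
      (Polynomial.C ((1 - A) / 2) * laguerrePoly i - (laguerrePoly i).derivative)).congr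
      (.of_forall fun x => ?_)
    dsimp only
    rw [mul_right_comm, ← Real.exp_add]
    ring_nf
  integrableOn_q i := by
    have hB : 0 ≤ max A 0 := le_max_right _ _
    refine (integrableOn_exp_mul_eval (c := (1 + max A 0) / 2) (by linarith)
      (laguerrePoly i)).congr (.of_forall fun x => ?_)
    dsimp only
    rw [mul_right_comm, ← Real.exp_neg, ← Real.exp_add]
    ring_nf
  integral_r i y hy := by
    have hy : 0 ≤ y := hy
    have hsub : Set.Ioi y ⊆ Set.Ici 0 := fun x hx => hy.trans (le_of_lt hx)
    rw [Set.inter_eq_right.2 hsub]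
    have h := integral_Ioi_exp_mul_eval (c := (1 - A) / 2) (by linarith) (laguerrePoly i) hy
    have e : ∀ x, Real.exp (-x / 2) * (Polynomial.C ((1 - A) / 2) * laguerrePoly i -
        (laguerrePoly i).derivative).eval x * (Real.exp (A * x / 2) / Real.exp (A * y / 2)) =
        (Real.exp (A * y / 2))⁻¹ * (Real.exp (-((1 - A) / 2) * x) *
          (Polynomial.C ((1 - A) / 2) * laguerrePoly i - (laguerrePoly i).derivative).eval x) := by
      intro x
      rw [show -((1 - A) / 2) * x = -x / 2 + A * x / 2 by ring, Real.exp_add]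
      ring
    simp only [e]
    rw [integral_const_mul, h, ← Real.exp_neg, ← mul_assoc, ← Real.exp_add]
    ring_nf
  integral_b i j := by
    have h := integral_laguerreL_mul i j
    simp only [Fin.val_inj] at h
    rw [← h]
    refine integral_congr_ae (.of_forall fun x => ?_)
    have e : Real.exp (-x) = Real.exp (-x / 2) * Real.exp (-x / 2) := by
      rw [← Real.exp_add, add_halves]
    simp only [eval_laguerrePoly, e]
    ring

lemma KL_eq_sum (n : ℕ) (x y : ℝ) : KL n x y = ∑ i : Fin n,
    Real.exp (-x / 2) * (laguerrePoly i).eval x * (Real.exp (-y / 2) * (laguerrePoly i).eval y) := by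
  rw [KL, ← Fin.sum_univ_eq_sum_range (fun l => laguerreL l x * laguerreL l y), Finset.mul_sum,
    show -(x + y) / 2 = -x / 2 + -y / 2 by ring, Real.exp_add]
  refine Finset.sum_congr rfl fun i _ => ?_
  rw [eval_laguerrePoly, eval_laguerrePoly]
  ring

lemma integral_exp_mul_KL (n : ℕ) (A t x : ℝ) :
    ∫ u in (0 : ℝ)..x, Real.exp (-A * u / 2) * KL n t u = ∑ i : Fin n,
      Real.exp (-t / 2) * (laguerrePoly i).eval t *
        ∫ u in (0 : ℝ)..x, Real.exp (-A * u / 2) * (Real.exp (-u / 2) * (laguerrePoly i).eval u) := by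
  simp only [KL_eq_sum, Finset.mul_sum, ← intervalIntegral.integral_const_mul]
  rw [← intervalIntegral.integral_finsetSum]
  · congr 1
    ext u
    exact Finset.sum_congr rfl fun i _ => by ring
  · intro i _
    exact (by fun_prop : Continuous _).intervalIntegrable _ _

lemma KL_comm (n : ℕ) (x y : ℝ) : KL n x y = KL n y x := by
  rw [KL_eq_sum, KL_eq_sum]
  exact Finset.sum_congr rfl fun i _ => mul_comm _ _

lemma hasDerivAt_exp_mul_laguerre (A x : ℝ) (p : Polynomial ℝ) :
    HasDerivAt (fun t => Real.exp (A * t / 2) * (Real.exp (-t / 2) * p.eval t))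
      (-(Real.exp (A * x / 2) * (Real.exp (-x / 2) *
        (Polynomial.C ((1 - A) / 2) * p - p.derivative).eval x))) x := by
  have e : ∀ t : ℝ, Real.exp (-((1 - A) / 2) * t) = Real.exp (A * t / 2) * Real.exp (-t / 2) := by
    intro t
    rw [← Real.exp_add]
    ring_nf
  have := hasDerivAt_exp_mul_eval ((1 - A) / 2) p x
  simpa only [e, mul_assoc] using this

lemma setIntegral_laguerre (A : ℝ) {x : ℝ} (hx : 0 ≤ x) (p : Polynomial ℝ) :
    ∫ y in Set.Ici 0 ∩ Set.Iio x, Real.exp (A * x / 2) / Real.exp (A * y / 2) *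
      (Real.exp (-y / 2) * p.eval y) = Real.exp (A * x / 2) *
        ∫ u in (0 : ℝ)..x, Real.exp (-A * u / 2) * (Real.exp (-u / 2) * p.eval u) := by
  rw [Set.Ici_inter_Iio, integral_Ico_eq_integral_Ioc, ← intervalIntegral.integral_of_le hx,
    ← intervalIntegral.integral_const_mul]
  congr 1
  ext y
  rw [div_eq_mul_inv, ← Real.exp_neg, neg_mul, neg_div, neg_div, mul_assoc]

/-- The determinant of the Laguerre system is the block determinant of the Laguerre kernels. -/
lemma laguerreSystem_D_eq {n : ℕ} {A : ℝ} (hA : A < 1) {k₁ k₂ : ℕ} {x : Fin k₁ → ℝ}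
    {y : Fin k₂ → ℝ} (hx : ∀ i, 0 ≤ x i) (hy : ∀ j, 0 ≤ y j) :
    (laguerreSystem n A hA).toBiorthogonalSystem.D x y =
      blockDet (KLoo n A) (KLoe n A) (KLeo n A) (KLee n) x y := by
  refine WeightedSystem.D_eq_blockDet _ hx hy ?_ ?_ ?_ ?_
  · intro x hx x' hx'
    have hx' : 0 ≤ x' := hx'
    simp only [laguerreSystem, setIntegral_laguerre A hx', KLoo, integral_exp_mul_KL]
    rw [(hasDerivAt_mul_sum (fun i : Fin n => hasDerivAt_exp_mul_laguerre A x (laguerrePoly i))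
      _).deriv, Finset.mul_sum]
    refine Finset.sum_congr rfl fun i _ => ?_
    rw [show -A * (x - x') / 2 = -(A * x / 2) + A * x' / 2 by ring, Real.exp_add, Real.exp_neg]
    field_simp
  · intro x hx y hy
    simp only [laguerreSystem, KLoe, KL_eq_sum]
    rw [(hasDerivAt_mul_sum (fun i : Fin n => hasDerivAt_exp_mul_laguerre A x (laguerrePoly i))
      _).deriv, Finset.mul_sum]
    refine Finset.sum_congr rfl fun i _ => ?_
    rw [show -A * x / 2 = -(A * x / 2) by ring, Real.exp_neg]
    field_simp
  · intro y hy x hx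
    have hx : 0 ≤ x := hx
    simp only [laguerreSystem, setIntegral_laguerre A hx, KLeo, KL_comm n _ y,
      integral_exp_mul_KL, Finset.mul_sum]
    congr 1
    · rw [← Real.exp_sub, show A * x / 2 - A * y / 2 = A * (x - y) / 2 by ring]
    · exact Finset.sum_congr rfl fun i _ => by ring
  · intro y hy y' hy'
    simp only [laguerreSystem, KLee, KL_eq_sum]

theorem laguerre_correlations {n : ℕ} {A : ℝ} (hA : A < 1) :
    Normalizable (laguerreWeight A (n := n)) ∧
      ∀ k₁ k₂ : ℕ, k₁ ≤ n → k₂ ≤ n → ∀ (x : Fin k₁ → ℝ) (y : Fin k₂ → ℝ),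
        (∀ i, 0 ≤ x i) → (∀ j, 0 ≤ y j) → (∀ i j, x i ≠ y j) →
          SliceIntegrable (laguerreDensity n A) x y ∧
          correlation (laguerreDensity n A) x y =
            blockDet (KLoo n A) (KLoe n A) (KLeo n A) (KLee n) x y := by
  have h := (laguerreSystem n A hA).correlation_eq (W := laguerreWeight A)
    (fun z hz hI => by
      rw [laguerreWeight, if_pos ⟨hz, hI⟩]
      congr 2
      refine Finset.prod_congr rfl fun j _ => ?_
      simp only [laguerreSystem]
      rw [← Real.exp_sub]
      ring_nf)
    (fun z hz => if_neg hz)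
  refine ⟨h.1, fun k₁ k₂ h₁ h₂ x y hx hy hxy => ?_⟩
  rw [← laguerreSystem_D_eq hA hx hy]
  exact h.2 k₁ k₂ h₁ h₂ x y hxy

/-! ### The Jacobi ensemble -/

lemma integrableOn_rpow_mul_eval {s : ℝ} (hs : -1 < s) (p : Polynomial ℝ) (c d : ℝ) :
    IntegrableOn (fun x : ℝ => (1 - x) ^ s * p.eval x) (Set.Ioc c d) := by
  have h := (integrableOn_Icc_iff_integrableOn_Ioc).2 (integrableOn_rpow_one_sub hs c d)
  exact (h.mul_continuousOn p.continuous.continuousOn isCompact_Icc).mono_set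
    Set.Ioc_subset_Icc_self

lemma hasDerivAt_rpow_mul_eval (s : ℝ) (p : Polynomial ℝ) {x : ℝ} (hx : x < 1) :
    HasDerivAt (fun x => (1 - x) ^ s * p.eval x) (-((1 - x) ^ (s - 1) *
      (Polynomial.C s * p - (1 - Polynomial.X) * p.derivative).eval x)) x := by
  have h0 : 0 < 1 - x := by linarith
  have h1 : HasDerivAt (fun x : ℝ => (1 - x) ^ s) (-(s * (1 - x) ^ (s - 1))) x := by
    have := ((hasDerivAt_id x).const_sub 1).rpow_const (p := s) (Or.inl h0.ne')
    refine this.congr_deriv ?_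
    simp only [id_eq]
    ring
  refine (h1.mul (p.hasDerivAt x)).congr_deriv ?_
  have h2 : (1 - x) ^ s = (1 - x) ^ (s - 1) * (1 - x) := by
    rw [← Real.rpow_add_one h0.ne', sub_add_cancel]
  simp only [Polynomial.eval_sub, Polynomial.eval_mul, Polynomial.eval_C, Polynomial.eval_one,
    Polynomial.eval_X]
  rw [h2]
  ring

/-- The derivative may be singular at 1, so the fundamental theorem is used with continuity up to
the endpoint and integrability. The boundary term at 1 vanishes because `s > 0`. -/
lemma integral_Ioc_rpow_mul_eval {s : ℝ} (hs : 0 < s) (p : Polynomial ℝ) {y : ℝ} (hy : y ≤ 1) :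
    ∫ x in Set.Ioc y 1, (1 - x) ^ (s - 1) *
      (Polynomial.C s * p - (1 - Polynomial.X) * p.derivative).eval x =
        (1 - y) ^ s * p.eval y := by
  have hint := (integrableOn_rpow_mul_eval (s := s - 1) (by linarith)
    (Polynomial.C s * p - (1 - Polynomial.X) * p.derivative) y 1).neg
  have hcont : ContinuousOn (fun x : ℝ => (1 - x) ^ s * p.eval x) (Set.Icc y 1) := by
    refine ContinuousOn.mul (Continuous.continuousOn ?_) p.continuous.continuousOn
    exact (continuous_const.sub continuous_id).rpow_const fun x => Or.inr hs.le
  have h := intervalIntegral.integral_eq_sub_of_hasDerivAt_of_le hy hcont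
    (fun x hx => hasDerivAt_rpow_mul_eval s p hx.2)
    ((intervalIntegrable_iff_integrableOn_Ioc_of_le hy).2 hint)
  rw [intervalIntegral.integral_of_le hy, integral_neg, sub_self, Real.zero_rpow hs.ne', zero_mul,
    zero_sub, neg_inj] at h
  exact h

lemma natDegree_sub_one_sub_X_mul_derivative_le {p : Polynomial ℝ} {i : ℕ} (hp : p.natDegree ≤ i)
    (c : ℝ) : (Polynomial.C c * p - (1 - Polynomial.X) * p.derivative).natDegree ≤ i := by
  refine (Polynomial.natDegree_sub_le _ _).trans (max_le
    ((Polynomial.natDegree_C_mul_le _ _).trans hp) ?_)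
  rcases Nat.eq_zero_or_pos i with h0 | h0
  · have : p.derivative = 0 := Polynomial.derivative_of_natDegree_zero (by omega)
    simp [this]
  · refine Polynomial.natDegree_mul_le.trans ?_
    have h1 : (1 - Polynomial.X : Polynomial ℝ).natDegree ≤ 1 :=
      (Polynomial.natDegree_sub_le _ _).trans (by simp)
    have h2 := Polynomial.natDegree_derivative_le p
    omega

/-- Unlike in the Laguerre case the derivative is multiplied by `1 - X` and so contributes `i` to
the factor in front of the top coefficient. -/
lemma coeff_sub_one_sub_X_mul_derivative {p : Polynomial ℝ} {i : ℕ} (hp : p.natDegree ≤ i)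
    (c : ℝ) : (Polynomial.C c * p - (1 - Polynomial.X) * p.derivative).coeff i =
      (c + i) * p.coeff i := by
  have h : p.coeff (i + 1) = 0 :=
    Polynomial.coeff_eq_zero_of_natDegree_lt (Nat.lt_succ_iff.2 hp)
  rw [sub_mul, one_mul, Polynomial.coeff_sub, Polynomial.coeff_sub, Polynomial.coeff_C_mul,
    Polynomial.coeff_derivative, h]
  rcases i with _ | i
  · simp
  · rw [Polynomial.coeff_X_mul, Polynomial.coeff_derivative]
    push_cast
    ring

/-- The orthonormal Jacobi polynomial. -/
noncomputable def jacobiOrthonormal (a : ℝ) (l : ℕ) : Polynomial ℝ :=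
  Polynomial.C (√(jacobiNorm a l))⁻¹ * jacobiPoly a l

lemma natDegree_jacobiOrthonormal_le (a : ℝ) (l : ℕ) : (jacobiOrthonormal a l).natDegree ≤ l :=
  (Polynomial.natDegree_C_mul_le _ _).trans (natDegree_jacobiPoly_le a l)

lemma eval_jacobiOrthonormal (a : ℝ) (l : ℕ) (x : ℝ) :
    (jacobiOrthonormal a l).eval x = (√(jacobiNorm a l))⁻¹ * jacobiP a 0 l x := by
  rw [jacobiOrthonormal, Polynomial.eval_mul, Polynomial.eval_C, eval_jacobiPoly]

lemma coeff_jacobiOrthonormal_ne_zero {a : ℝ} (ha : -1 < a) (l : ℕ) :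
    (jacobiOrthonormal a l).coeff l ≠ 0 := by
  rw [jacobiOrthonormal, Polynomial.coeff_C_mul, coeff_jacobiPoly]
  exact mul_ne_zero (inv_ne_zero (Real.sqrt_pos.2 (jacobiNorm_pos ha l)).ne')
    (mul_ne_zero (jacobiCoeff_self_ne_zero ha l) (pow_ne_zero _ (by norm_num)))

lemma integral_jacobiOrthonormal_mul {a : ℝ} (ha : -1 < a) (i j : ℕ) :
    ∫ x in Set.Ioo (-1 : ℝ) 1, (1 - x) ^ a *
      ((jacobiOrthonormal a i).eval x * (jacobiOrthonormal a j).eval x) =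
        if i = j then 1 else 0 := by
  have e : ∀ x : ℝ, (1 - x) ^ a *
      ((jacobiOrthonormal a i).eval x * (jacobiOrthonormal a j).eval x) =
      (√(jacobiNorm a i))⁻¹ * (√(jacobiNorm a j))⁻¹ *
        ((1 - x) ^ a * (jacobiP a 0 i x * jacobiP a 0 j x)) := by
    intro x
    rw [eval_jacobiOrthonormal, eval_jacobiOrthonormal]
    ring
  simp only [e]
  rw [integral_const_mul, integral_jacobiP_mul ha]
  split_ifs with h
  · subst h
    rw [← mul_inv, Real.mul_self_sqrt (jacobiNorm_pos ha i).le,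
      inv_mul_cancel₀ (jacobiNorm_pos ha i).ne']
  · simp

/-- The weighted system of the Jacobi ensemble. -/
noncomputable def jacobiSystem (n : ℕ) (a A : ℝ) (ha : -1 < a) (hA : A < a + 1) :
    WeightedSystem n where
  I := Set.Ioo (-1) 1
  w x := (1 - x) ^ ((a - 1) / 2)
  g x := (1 - x) ^ (-A / 2)
  -- As in the Laguerre case, `max A 0` keeps `w * q i / u` integrable near 1 for very negative `A`,
  -- while `A < a + 1` keeps `w * r i * u` integrable.
  u x := (1 - x) ^ (-(max A 0) / 2)
  q i := jacobiOrthonormal a i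
  r i := Polynomial.C ((a + 1 - A) / 2) * jacobiOrthonormal a i -
    (1 - Polynomial.X) * (jacobiOrthonormal a i).derivative
  -- Here `w * r i * g` is minus the derivative of `(1 - x) * g * w * q i`. The extra factor `1 - y`
  -- turns `w²` into the Jacobi weight `(1 - y)^a` and reappears in the even-even kernel.
  b i y := (1 - y) * ((1 - y) ^ ((a - 1) / 2) * (jacobiOrthonormal a i).eval y)
  measurableSet_I := measurableSet_Ioo
  measurable_w := by fun_prop
  measurable_g := by fun_prop
  w_pos x hx := Real.rpow_pos_of_pos (sub_pos.2 hx.2) _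
  g_pos x hx := Real.rpow_pos_of_pos (sub_pos.2 hx.2) _
  u_pos x hx := Real.rpow_pos_of_pos (sub_pos.2 hx.2) _
  natDegree_q_le i := natDegree_jacobiOrthonormal_le a i
  natDegree_r_le i :=
    natDegree_sub_one_sub_X_mul_derivative_le (natDegree_jacobiOrthonormal_le a i) _
  coeff_pos i := by
    rw [coeff_sub_one_sub_X_mul_derivative (natDegree_jacobiOrthonormal_le a i), mul_assoc]
    have : (0 : ℝ) ≤ (i : ℕ) := by positivity
    exact mul_pos (by linarith) (mul_self_pos.2 (coeff_jacobiOrthonormal_ne_zero ha i))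
  ratio_le x hx y hy hxy := by
    have h1 : 0 < 1 - x := sub_pos.2 hx.2
    have h2 : 0 < 1 - y := sub_pos.2 hy.2
    rw [← Real.div_rpow h1.le h2.le, ← Real.div_rpow h1.le h2.le]
    refine Real.rpow_le_rpow_of_exponent_ge (div_pos h1 h2) ((div_le_one h2).2 (by linarith)) ?_
    linarith [le_max_left A 0]
  integrableOn_r i := by
    have hB : max A 0 < a + 1 := max_lt hA (by linarith)
    refine ((integrableOn_rpow_mul_eval (s := (a - 1) / 2 + -(max A 0) / 2) (by linarith)
      (Polynomial.C ((a + 1 - A) / 2) * jacobiOrthonormal a i -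
        (1 - Polynomial.X) * (jacobiOrthonormal a i).derivative) (-1) 1).mono_set
          Set.Ioo_subset_Ioc_self).congr_fun (fun x hx => ?_) measurableSet_Ioo
    dsimp only
    rw [Real.rpow_add (sub_pos.2 hx.2)]
    ring
  integrableOn_q i := by
    have hB : 0 ≤ max A 0 := le_max_right _ _
    refine ((integrableOn_rpow_mul_eval (s := (a - 1) / 2 + (max A 0) / 2) (by linarith)
      (jacobiOrthonormal a i) (-1) 1).mono_set
          Set.Ioo_subset_Ioc_self).congr_fun (fun x hx => ?_) measurableSet_Ioo
    dsimp only
    rw [Real.rpow_add (sub_pos.2 hx.2), neg_div, Real.rpow_neg (sub_pos.2 hx.2).le, inv_inv]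
    ring
  integral_r i y hy := by
    have hset : Set.Ioo (-1 : ℝ) 1 ∩ Set.Ioi y = Set.Ioo y 1 := by
      rw [Set.Ioo_inter_Ioi, max_eq_right hy.1.le]
    have hy0 : 0 < 1 - y := sub_pos.2 hy.2
    have h := integral_Ioc_rpow_mul_eval (s := (a + 1 - A) / 2) (by linarith)
      (jacobiOrthonormal a i) hy.2.le
    have e : ∀ x ∈ Set.Ioo y 1, (1 - x) ^ ((a - 1) / 2) *
        (Polynomial.C ((a + 1 - A) / 2) * jacobiOrthonormal a i -
          (1 - Polynomial.X) * (jacobiOrthonormal a i).derivative).eval x *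
            ((1 - x) ^ (-A / 2) / (1 - y) ^ (-A / 2)) =
        ((1 - y) ^ (-A / 2))⁻¹ * ((1 - x) ^ ((a + 1 - A) / 2 - 1) *
          (Polynomial.C ((a + 1 - A) / 2) * jacobiOrthonormal a i -
            (1 - Polynomial.X) * (jacobiOrthonormal a i).derivative).eval x) := by
      intro x hx
      rw [show (a + 1 - A) / 2 - 1 = (a - 1) / 2 + -A / 2 by ring,
        Real.rpow_add (sub_pos.2 hx.2)]
      ring
    rw [hset, setIntegral_congr_fun measurableSet_Ioo e, integral_const_mul,
      ← integral_Ioc_eq_integral_Ioo, h,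
      show (a + 1 - A) / 2 = 1 + (a - 1) / 2 + -A / 2 by ring, Real.rpow_add hy0,
      Real.rpow_add hy0, Real.rpow_one]
    have : (1 - y) ^ (-A / 2) ≠ 0 := (Real.rpow_pos_of_pos hy0 _).ne'
    field_simp
  integral_b i j := by
    have h := integral_jacobiOrthonormal_mul ha i j
    simp only [Fin.val_inj] at h
    rw [← h]
    refine setIntegral_congr_fun measurableSet_Ioo fun x hx => ?_
    have e : (1 - x) ^ a = (1 - x) * (1 - x) ^ ((a - 1) / 2) * (1 - x) ^ ((a - 1) / 2) := by
      have h0 : 0 < 1 - x := sub_pos.2 hx.2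
      rw [mul_assoc, ← Real.rpow_add h0, mul_comm, ← Real.rpow_add_one h0.ne']
      ring_nf
    rw [e]
    ring

lemma KJ_eq_sum {a : ℝ} (ha : -1 < a) (n : ℕ) (x y : ℝ) : KJ a n x y = ∑ i : Fin n,
    (1 - x) ^ ((a - 1) / 2) * (jacobiOrthonormal a i).eval x *
      ((1 - y) ^ ((a - 1) / 2) * (jacobiOrthonormal a i).eval y) := by
  rw [KJ, ← Fin.sum_univ_eq_sum_range (fun l => 1 / jacobiNorm a l * jacobiP a 0 l x *
    jacobiP a 0 l y), Finset.mul_sum]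
  refine Finset.sum_congr rfl fun i _ => ?_
  rw [eval_jacobiOrthonormal, eval_jacobiOrthonormal]
  have : 1 / jacobiNorm a i = (√(jacobiNorm a i))⁻¹ * (√(jacobiNorm a i))⁻¹ := by
    rw [← mul_inv, Real.mul_self_sqrt (jacobiNorm_pos ha i).le, one_div]
  rw [this]
  ring

lemma KJ_comm {a : ℝ} (ha : -1 < a) (n : ℕ) (x y : ℝ) : KJ a n x y = KJ a n y x := by
  rw [KJ_eq_sum ha, KJ_eq_sum ha]
  exact Finset.sum_congr rfl fun i _ => mul_comm _ _

lemma integral_rpow_mul_KJ {a : ℝ} (ha : -1 < a) (n : ℕ) (A t : ℝ) {x : ℝ}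
    (hx : x ∈ Set.Ioo (-1 : ℝ) 1) :
    ∫ u in (-1 : ℝ)..x, (1 - u) ^ (A / 2) * KJ a n t u = ∑ i : Fin n,
      (1 - t) ^ ((a - 1) / 2) * (jacobiOrthonormal a i).eval t *
        ∫ u in (-1 : ℝ)..x, (1 - u) ^ (A / 2) *
          ((1 - u) ^ ((a - 1) / 2) * (jacobiOrthonormal a i).eval u) := by
  simp only [KJ_eq_sum ha, Finset.mul_sum, ← intervalIntegral.integral_const_mul]
  rw [← intervalIntegral.integral_finsetSum]
  · congr 1
    ext u
    exact Finset.sum_congr rfl fun i _ => by ring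
  · intro i _
    refine ContinuousOn.intervalIntegrable ?_
    have hr : ∀ s : ℝ, ContinuousOn (fun u : ℝ => (1 - u) ^ s) (Set.uIcc (-1) x) := by
      intro s
      refine ContinuousOn.rpow_const (by fun_prop) fun u hu => Or.inl ?_
      rw [Set.uIcc_of_le hx.1.le] at hu
      linarith [hu.2, hx.2]
    exact continuousOn_const.mul ((hr _).mul ((hr _).mul
      (jacobiOrthonormal a i).continuous.continuousOn))

lemma hasDerivAt_rpow_mul_jacobi (a A : ℝ) (p : Polynomial ℝ) {x : ℝ} (hx : x < 1) :
    HasDerivAt (fun t => (1 - t) ^ (1 - A / 2) * ((1 - t) ^ ((a - 1) / 2) * p.eval t))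
      (-((1 - x) ^ (-A / 2) * ((1 - x) ^ ((a - 1) / 2) * (Polynomial.C ((a + 1 - A) / 2) * p -
        (1 - Polynomial.X) * p.derivative).eval x))) x := by
  have h := hasDerivAt_rpow_mul_eval ((a + 1 - A) / 2) p hx
  have e : (1 - x) ^ ((a + 1 - A) / 2 - 1) = (1 - x) ^ (-A / 2) * (1 - x) ^ ((a - 1) / 2) := by
    rw [← Real.rpow_add (sub_pos.2 hx)]
    ring_nf
  rw [e, mul_assoc] at h
  refine h.congr_of_eventuallyEq ?_
  -- Exponents of real powers can be merged only for `t < 1`, so the two functions are compared near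
  -- `x` rather than everywhere.
  filter_upwards [eventually_lt_nhds hx] with t ht
  rw [← mul_assoc, ← Real.rpow_add (sub_pos.2 ht)]
  ring_nf

lemma setIntegral_jacobi (a A : ℝ) {x : ℝ} (hx : x ∈ Set.Ioo (-1 : ℝ) 1) (p : Polynomial ℝ) :
    ∫ y in Set.Ioo (-1) 1 ∩ Set.Iio x, (1 - x) ^ (-A / 2) / (1 - y) ^ (-A / 2) *
      ((1 - y) ^ ((a - 1) / 2) * p.eval y) = (1 - x) ^ (-A / 2) *
        ∫ u in (-1 : ℝ)..x, (1 - u) ^ (A / 2) * ((1 - u) ^ ((a - 1) / 2) * p.eval u) := by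
  rw [Set.Ioo_inter_Iio, min_eq_right hx.2.le, ← integral_Ioc_eq_integral_Ioo,
    ← intervalIntegral.integral_of_le hx.1.le, ← intervalIntegral.integral_const_mul]
  refine intervalIntegral.integral_congr fun y hy => ?_
  rw [Set.uIcc_of_le hx.1.le] at hy
  have hy0 : 0 < 1 - y := by linarith [hy.2, hx.2]
  rw [div_eq_mul_inv, ← Real.rpow_neg hy0.le, neg_div, neg_neg, mul_assoc]

/-- The determinant of the Jacobi system is the block determinant of the Jacobi kernels. -/
lemma jacobiSystem_D_eq {n : ℕ} {a A : ℝ} (ha : -1 < a) (hA : A < a + 1) {k₁ k₂ : ℕ}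
    {x : Fin k₁ → ℝ} {y : Fin k₂ → ℝ} (hx : ∀ i, x i ∈ Set.Ioo (-1 : ℝ) 1)
    (hy : ∀ j, y j ∈ Set.Ioo (-1 : ℝ) 1) :
    (jacobiSystem n a A ha hA).toBiorthogonalSystem.D x y =
      blockDet (KJoo n a A) (KJoe n a A) (KJeo n a A) (KJee n a) x y := by
  have hinv : ∀ {x : ℝ}, x ∈ Set.Ioo (-1 : ℝ) 1 → (1 - x) ^ (A / 2) * (1 - x) ^ (-A / 2) = 1 := by
    intro x hx
    rw [← Real.rpow_add (sub_pos.2 hx.2), neg_div, add_neg_cancel, Real.rpow_zero]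
  refine WeightedSystem.D_eq_blockDet _ hx hy ?_ ?_ ?_ ?_
  · intro x hx x' hx'
    have hx : x ∈ Set.Ioo (-1 : ℝ) 1 := hx
    have hx' : x' ∈ Set.Ioo (-1 : ℝ) 1 := hx'
    simp only [jacobiSystem, setIntegral_jacobi a A hx', KJoo, integral_rpow_mul_KJ ha n A _ hx']
    rw [(hasDerivAt_mul_sum (fun i : Fin n => hasDerivAt_rpow_mul_jacobi a A
      (jacobiOrthonormal a i) hx.2) _).deriv, Finset.mul_sum]
    refine Finset.sum_congr rfl fun i _ => ?_
    rw [Real.div_rpow (sub_pos.2 hx.2).le (sub_pos.2 hx'.2).le, div_eq_mul_inv,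
      ← Real.rpow_neg (sub_pos.2 hx'.2).le, ← neg_div]
    generalize (∫ u in (-1 : ℝ)..x', (1 - u) ^ (A / 2) *
      ((1 - u) ^ ((a - 1) / 2) * (jacobiOrthonormal a i).eval u)) = J
    generalize (Polynomial.C ((a + 1 - A) / 2) * jacobiOrthonormal a i -
      (1 - Polynomial.X) * (jacobiOrthonormal a i).derivative).eval x = R
    linear_combination ((1 - x') ^ (-A / 2) * (1 - x) ^ ((a - 1) / 2) * R * J) * hinv hx
  · intro x hx y hy
    have hx : x ∈ Set.Ioo (-1 : ℝ) 1 := hx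
    simp only [jacobiSystem, KJoe, KJ_eq_sum ha]
    rw [(hasDerivAt_mul_sum (fun i : Fin n => hasDerivAt_rpow_mul_jacobi a A
      (jacobiOrthonormal a i) hx.2) _).deriv, Finset.mul_sum]
    refine Finset.sum_congr rfl fun i _ => ?_
    generalize (Polynomial.C ((a + 1 - A) / 2) * jacobiOrthonormal a i -
      (1 - Polynomial.X) * (jacobiOrthonormal a i).derivative).eval x = R
    linear_combination ((1 - x) ^ ((a - 1) / 2) * R * ((1 - y) ^ ((a - 1) / 2) *
      (jacobiOrthonormal a i).eval y)) * hinv hx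
  · intro y hy x hx
    have hx : x ∈ Set.Ioo (-1 : ℝ) 1 := hx
    have hy : y ∈ Set.Ioo (-1 : ℝ) 1 := hy
    simp only [jacobiSystem, setIntegral_jacobi a A hx, KJeo, KJ_comm ha n _ y,
      integral_rpow_mul_KJ ha n A _ hx, Finset.mul_sum]
    congr 1
    · rw [Real.div_rpow (sub_pos.2 hx.2).le (sub_pos.2 hy.2).le]
    · exact Finset.sum_congr rfl fun i _ => by ring
  · intro y hy y' hy'
    simp only [jacobiSystem, KJee, KJ_eq_sum ha, Finset.mul_sum]
    exact Finset.sum_congr rfl fun i _ => by ring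

theorem jacobi_correlations {n : ℕ} {a A : ℝ} (ha : -1 < a) (hA : A < a + 1) :
    Normalizable (jacobiWeight a A (n := n)) ∧
      ∀ k₁ k₂ : ℕ, k₁ ≤ n → k₂ ≤ n → ∀ (x : Fin k₁ → ℝ) (y : Fin k₂ → ℝ),
        (∀ i, x i ∈ Set.Ioo (-1 : ℝ) 1) → (∀ j, y j ∈ Set.Ioo (-1 : ℝ) 1) →
        (∀ i j, x i ≠ y j) →
          SliceIntegrable (jacobiDensity n a A) x y ∧
          correlation (jacobiDensity n a A) x y =
            blockDet (KJoo n a A) (KJoe n a A) (KJeo n a A) (KJee n a) x y := by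
  have h := (jacobiSystem n a A ha hA).correlation_eq (W := jacobiWeight a A)
    (fun z hz hI => by
      rw [jacobiWeight, if_pos ⟨hz, hI⟩]
      congr 2
      refine Finset.prod_congr rfl fun j _ => ?_
      exact Real.div_rpow (sub_pos.2 (hI _).2).le (sub_pos.2 (hI _).2).le _)
    (fun z hz => if_neg hz)
  refine ⟨h.1, fun k₁ k₂ h₁ h₂ x y hx hy hxy => ?_⟩
  rw [← jacobiSystem_D_eq ha hA hx hy]
  exact h.2 k₁ k₂ h₁ h₂ x y hxy

end SuperimposedEnsemble

/-! ### The main theorem -/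

theorem mainTheorem1 (n : ℕ) :
    -- Laguerre case
    ((∀ A : ℝ, A < 1 →
        Normalizable (laguerreWeight A (n := n)) ∧
        ∀ k₁ k₂ : ℕ, k₁ ≤ n → k₂ ≤ n → ∀ (x : Fin k₁ → ℝ) (y : Fin k₂ → ℝ),
          (∀ i, 0 ≤ x i) → (∀ j, 0 ≤ y j) → (∀ i j, x i ≠ y j) →
            SliceIntegrable (laguerreDensity n A) x y ∧
            correlation (laguerreDensity n A) x y =
              blockDet (KLoo n A) (KLoe n A) (KLeo n A) (KLee n) x y) ∧
      (∀ k : ℕ, k ≤ n → ∀ y : Fin k → ℝ, (∀ j, 0 ≤ y j) → ∀ A : ℝ, A < 1 →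
        correlation (laguerreDensity n A) (Fin.elim0 : Fin 0 → ℝ) y =
          (Matrix.of fun j l : Fin k => KL n (y j) (y l)).det)) ∧
    -- Jacobi case
    (∀ a : ℝ, -1 < a →
      (∀ A : ℝ, A < a + 1 →
        Normalizable (jacobiWeight a A (n := n)) ∧
        ∀ k₁ k₂ : ℕ, k₁ ≤ n → k₂ ≤ n → ∀ (x : Fin k₁ → ℝ) (y : Fin k₂ → ℝ),
          (∀ i, x i ∈ Set.Ioo (-1 : ℝ) 1) → (∀ j, y j ∈ Set.Ioo (-1 : ℝ) 1) →
          (∀ i j, x i ≠ y j) →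
            SliceIntegrable (jacobiDensity n a A) x y ∧
            correlation (jacobiDensity n a A) x y =
              blockDet (KJoo n a A) (KJoe n a A) (KJeo n a A) (KJee n a) x y) ∧
      (∀ k : ℕ, k ≤ n → ∀ y : Fin k → ℝ, (∀ j, y j ∈ Set.Ioo (-1 : ℝ) 1) →
        ∀ A : ℝ, A < a + 1 →
          correlation (jacobiDensity n a A) (Fin.elim0 : Fin 0 → ℝ) y =
            (Matrix.of fun j l : Fin k => (1 - y j) * KJ a n (y j) (y l)).det)) := by
  refine ⟨⟨fun A hA => laguerre_correlations hA, fun k hk y hy A hA => ?_⟩,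
    fun a ha => ⟨fun A hA => jacobi_correlations ha hA, fun k hk y hy A hA => ?_⟩⟩
  -- Without odd points the condition on coincidences is void and the block determinant is its
  -- even-even block.
  · rw [((laguerre_correlations hA).2 0 k n.zero_le hk Fin.elim0 y (fun i => i.elim0) hy
      (fun i => i.elim0)).2, blockDet_elim0]
    rfl
  · rw [((jacobi_correlations ha hA).2 0 k n.zero_le hk Fin.elim0 y (fun i => i.elim0) hy
      (fun i => i.elim0)).2, blockDet_elim0]
    rfl
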